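/- Let $\mathbb k$ be a field, let $H$ be a Hopf algebra over $\mathbb k$ with counit $\epsilon$ and antipode $S$, let $H^e=H\otimes_{\mathbb k}H^{\rm op}$ (so that left $H^e$-modules are the $H$-bimodules on which $\mathbb k$ acts centrally), and let $d\in\mathbb N$. The bimodule $\mathrm{Ext}^i_{H^e}(H,H^e)$ is computed with the left $H^e$-module structure of $H^e$, and its bimodule structure comes from right multiplication on $H^e$, that is, from $h\cdot(x\otimes y)\cdot k=xk\otimes hy$. Assume that $H$ has Van den Bergh duality with dimension $d$: the left $H^e$-module $H$ has a finite resolution by finitely generated projective $H^e$-modules, $\mathrm{Ext}^i_{H^e}(H,H^e)=0$ for $i\neq d$, and the $H$-bimodule $U=\mathrm{Ext}^d_{H^e}(H,H^e)$ is invertible (there is an $H$-bimodule $V$ with $U\otimes_HV\simeq H\simeq V\otimes_HU$ as $H$-bimodules). Then: 1. $H$ is right Artin–Schelter regular with dimension $d$. That is, writing $\mathbb k_H$ for the right $H$-module $\mathbb k$ defined by $\epsilon$, the $\mathbb k$-vector space $\mathrm{Ext}^i_{H^{\rm op}}(\mathbb k_H,H)$ has dimension $1$ if $i=d$ and is zero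 otherwise; the injective dimensions of the left $H$-module $H$ and of the right $H$-module $H$ are finite and equal; and the left and right global dimensions of $H$ are finite. In particular there is a unique algebra homomorphism $\int_r\colon H\to\mathbb k$ (the right homological integral) such that the left $H$-module structure of $\mathrm{Ext}^d_{H^{\rm op}}(\mathbb k_H,H)$ induced by left multiplication on $H$ is $h\rightharpoonup\alpha=\int_r(h)\,\alpha$. 2. $\mathrm{Ext}^d_{H^e}(H,H^e)\simeq{}^{\,S^2\circ\Xi^r_{\int_r}}H$ as $H$-bimodules, where $\Xi^r_{\int_r}\colon H\to H$, $h\mapsto h_1\int_r(h_2)$, is the right winding automorphism, and, for an algebra endomorphism $\sigma$ of $H$, ${}^{\sigma}H$ is the vector space $H$ with bimodule structure $a\cdot x\cdot b=\sigma(a)\,x\,b$. Consequently, the antipode $S$ of $H$ is invertible. -/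

import Mathlib

open CategoryTheory TensorProduct MulOpposite

universe u

namespace HopfDuality

noncomputable section

/-! ### Functoriality of `Ext` in the second argument -/

/-- If a ring `B` acts on the left `A`-module `N` by `A`-linear endomorphisms, then it acts on
`Ext^n_A(M, N)` by functoriality in `N`: `b • α` is the Yoneda product of `α` with the
endomorphism `b` of `N`. -/
abbrev extModule {A B : Type u} [Ring A] [Ring B] (M N : ModuleCat.{u} A)
    (ρ : B →+* Module.End A N) (n : ℕ) : Module B (Abelian.Ext.{u} M N n) where
  smul b α := α.comp (Abelian.Ext.mk₀ (ModuleCat.ofHom (ρ b))) (add_zero n)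
  one_smul α := by
    change α.comp (Abelian.Ext.mk₀ (ModuleCat.ofHom (ρ 1))) (add_zero n) = α
    rw [map_one]
    exact α.comp_mk₀_id
  mul_smul a b α := by
    change α.comp (Abelian.Ext.mk₀ (ModuleCat.ofHom (ρ (a * b)))) (add_zero n) =
      (α.comp (Abelian.Ext.mk₀ (ModuleCat.ofHom (ρ b))) (add_zero n)).comp
        (Abelian.Ext.mk₀ (ModuleCat.ofHom (ρ a))) (add_zero n)
    rw [Abelian.Ext.comp_assoc_of_second_deg_zero, Abelian.Ext.mk₀_comp_mk₀, map_mul]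
    rfl
  smul_zero b := by
    change (0 : Abelian.Ext.{u} M N n).comp (Abelian.Ext.mk₀ (ModuleCat.ofHom (ρ b)))
      (add_zero n) = 0
    rw [Abelian.Ext.zero_comp]
  smul_add b α β := Abelian.Ext.add_comp _ _ _ (add_zero n)
  add_smul a b α := by
    change α.comp (Abelian.Ext.mk₀ (ModuleCat.ofHom (ρ (a + b)))) (add_zero n) =
      α.comp (Abelian.Ext.mk₀ (ModuleCat.ofHom (ρ a))) (add_zero n) +
        α.comp (Abelian.Ext.mk₀ (ModuleCat.ofHom (ρ b))) (add_zero n)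
    rw [map_add, ← Abelian.Ext.comp_add, ← Abelian.Ext.mk₀_add]
    rfl
  zero_smul α := by
    change α.comp (Abelian.Ext.mk₀ (ModuleCat.ofHom (ρ 0))) (add_zero n) = 0
    rw [map_zero]
    have : ModuleCat.ofHom (0 : Module.End A N) = 0 := rfl
    rw [this, Abelian.Ext.mk₀_zero, Abelian.Ext.comp_zero]

/-! ### Bimodules -/

section Bimodules

variable (k A : Type u) [Field k] [Ring A] [Algebra k A]

/-- The enveloping algebra `A^e = A ⊗ A^op`. An `A`-bimodule `M` (with `k` acting centrally) is
the same thing as a left `A^e`-module: `a m b = (a ⊗ op b) • m`. -/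
abbrev Env : Type u := A ⊗[k] Aᵐᵒᵖ

variable {k A} in
/-- The left action of `a` on an `A`-bimodule is the action of `a ⊗ 1`. -/
abbrev lft (a : A) : Env k A := a ⊗ₜ[k] 1

variable {k A} in
/-- The right action of `b` on an `A`-bimodule is the action of `1 ⊗ op b`. -/
abbrev rgt (b : A) : Env k A := 1 ⊗ₜ[k] op b

/-- The regular bimodule `A`, with `(a ⊗ op b) • x = a x b`. -/
def regularBimodule : ModuleCat.{u} (Env k A) :=
  letI : Module (Env k A) A := instModuleTensorProductMop k A
  ModuleCat.of (Env k A) A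

variable {k A} in
/-- The twisted bimodule `^σ A`, with `(a ⊗ op b) • x = σ(a) x b`. -/
def leftTwist (σ : A →ₐ[k] A) : ModuleCat.{u} (Env k A) :=
  (ModuleCat.restrictScalars
    (Algebra.TensorProduct.map σ (AlgHom.id k Aᵐᵒᵖ)).toRingHom).obj (regularBimodule k A)

/-- The free bimodule `A^e` with its outer structure, that is, `A^e` as a left module over
itself. -/
abbrev envModule : ModuleCat.{u} (Env k A) := ModuleCat.of (Env k A) (Env k A)

/-- The algebra isomorphism `A^e ≃ (A^e)^op`, `a ⊗ op b ↦ op (b ⊗ op a)`, by which right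
`A^e`-modules are `A`-bimodules. -/
def envSwap : Env k A →ₐ[k] (Env k A)ᵐᵒᵖ :=
  Algebra.TensorProduct.lift
    ((AlgHom.op (Algebra.TensorProduct.includeRight : Aᵐᵒᵖ →ₐ[k] Env k A)).comp
      (AlgEquiv.opOp k A).toAlgHom)
    (AlgHom.op (Algebra.TensorProduct.includeLeft : A →ₐ[k] Env k A))
    (fun a b => by
      apply MulOpposite.unop_injective
      simp)

/-- The action of `A^e` on the left `A^e`-module `A^e` coming from right multiplication (the inner
bimodule structure): `a ⊗ op b` sends `x ⊗ op y` to `(x ⊗ op y)(b ⊗ op a)`, that is, to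
`x b ⊗ op (a y)`. -/
def innerAction : Env k A →+* Module.End (Env k A) (Env k A) :=
  (Module.toModuleEnd (Env k A) (Env k A) (S := (Env k A)ᵐᵒᵖ)).comp (envSwap k A).toRingHom

theorem innerAction_tmul (a b x y : A) :
    innerAction k A (a ⊗ₜ op b) (x ⊗ₜ op y) = (x * b) ⊗ₜ op (a * y) := by
  have h : envSwap k A (a ⊗ₜ op b) = op (b ⊗ₜ op a) := by
    apply MulOpposite.unop_injective
    refine (congrArg MulOpposite.unop (Algebra.TensorProduct.lift_tmul _ _ _ _ _)).trans ?_
    simp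
  change (x ⊗ₜ[k] op y) * (envSwap k A (a ⊗ₜ op b)).unop = _
  rw [h]
  simp

/-- `Ext^n_{A^e}(A, A^e)`. -/
def DualExt (n : ℕ) : Type u := Abelian.Ext.{u} (regularBimodule k A) (envModule k A) n

instance (n : ℕ) : AddCommGroup (DualExt k A n) :=
  inferInstanceAs (AddCommGroup (Abelian.Ext.{u} (regularBimodule k A) (envModule k A) n))

/-- The bimodule structure on `Ext^n_{A^e}(A, A^e)` induced by the inner structure of `A^e`. -/
instance (n : ℕ) : Module (Env k A) (DualExt k A n) :=
  extModule (regularBimodule k A) (envModule k A) (innerAction k A) n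

section Tensor

variable (U V : Type u) [AddCommGroup U] [Module (Env k A) U]
  [AddCommGroup V] [Module (Env k A) V]

/-- The subgroup of `U ⊗_ℤ V` generated by the elements `ua ⊗ v - u ⊗ av`. -/
def balancedSubgroup : AddSubgroup (U ⊗[ℤ] V) :=
  AddSubgroup.closure
    {t | ∃ (u : U) (a : A) (v : V),
      t = ((rgt a : Env k A) • u) ⊗ₜ[ℤ] v - u ⊗ₜ[ℤ] ((lft a : Env k A) • v)}

/-- The tensor product `U ⊗_A V` of two `A`-bimodules over the (noncommutative) ring `A`. -/
abbrev BalancedTensor : Type u := (U ⊗[ℤ] V) ⧸ balancedSubgroup k A U V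

variable {U V} in
/-- The element `u ⊗ v` of `U ⊗_A V`. -/
def bmk (u : U) (v : V) : BalancedTensor k A U V := QuotientAddGroup.mk (u ⊗ₜ[ℤ] v)

/-- `U ⊗_A V ≃ A` as `A`-bimodules, where the bimodule structure of `U ⊗_A V` is given on the
generators `u ⊗ v` by `a (u ⊗ v) b = au ⊗ vb`. -/
def TensorIsoRegular : Prop :=
  ∃ φ : BalancedTensor k A U V ≃+ A, ∀ (a b : A) (u : U) (v : V),
    φ (bmk k A ((lft a : Env k A) • u) ((rgt b : Env k A) • v)) = a * φ (bmk k A u v) * b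

/-- An `A`-bimodule `U` is invertible if there is an `A`-bimodule `V` such that `U ⊗_A V` and
`V ⊗_A U` are isomorphic to `A` as `A`-bimodules. -/
def IsInvertibleBimodule : Prop :=
  ∃ (V : Type u) (_ : AddCommGroup V) (_ : Module (Env k A) V),
    TensorIsoRegular k A U V ∧ TensorIsoRegular k A V U

end Tensor

/-- The left module `M` has a finite resolution by finitely generated projective modules. -/
def HasFiniteFGProjectiveResolution {R : Type u} [Ring R] (M : ModuleCat.{u} R) : Prop :=
  ∃ P : ProjectiveResolution M, (∀ i, Module.Finite R (P.complex.X i)) ∧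
    ∃ m : ℕ, ∀ i, m < i → Limits.IsZero (P.complex.X i)

/-- `A` has Van den Bergh duality with dimension `d`: it is homologically smooth, the bimodules
`Ext^i_{A^e}(A, A^e)` vanish for `i ≠ d`, and `Ext^d_{A^e}(A, A^e)` is an invertible bimodule. -/
structure HasVanDenBerghDuality (d : ℕ) : Prop where
  smooth : HasFiniteFGProjectiveResolution (regularBimodule k A)
  vanishing : ∀ i : ℕ, i ≠ d → Subsingleton (DualExt k A i)
  invertible : IsInvertibleBimodule k A (DualExt k A d)

end Bimodules

/-! ### The right Artin–Schelter condition -/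

section ArtinSchelter

variable {k A : Type u} [Field k] [Ring A] [Algebra k A] (ε : A →ₐ[k] k)

/-- The right `A`-module `k_A` of an augmented algebra `(A, ε)`, with `c · a = c ε(a)`.
Right `A`-modules are left `A^op`-modules. -/
def trivialRight : ModuleCat.{u} Aᵐᵒᵖ :=
  (ModuleCat.restrictScalars
    (ε.fromOpposite (fun _ _ => mul_comm _ _)).toRingHom).obj (ModuleCat.of k k)

/-- `Ext^n_{A^op}(k_A, A)`, computed in the category of right `A`-modules. -/
def RightExt (n : ℕ) : Type u := Abelian.Ext.{u} (trivialRight ε) (ModuleCat.of Aᵐᵒᵖ A) n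

instance (n : ℕ) : AddCommGroup (RightExt ε n) :=
  inferInstanceAs (AddCommGroup (Abelian.Ext.{u} (trivialRight ε) (ModuleCat.of Aᵐᵒᵖ A) n))

/-- The left `A`-module structure on `Ext^n_{A^op}(k_A, A)` induced by left multiplication
on `A`. -/
instance (n : ℕ) : Module A (RightExt ε n) :=
  extModule (trivialRight ε) (ModuleCat.of Aᵐᵒᵖ A) (Module.toModuleEnd Aᵐᵒᵖ A (S := A)) n

/-- The `k`-vector space structure on `Ext^n_{A^op}(k_A, A)`. -/
instance (n : ℕ) : Module k (RightExt ε n) :=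
  Module.compHom (RightExt ε n) (algebraMap k A)

/-- The right Artin–Schelter condition with dimension `n`: `Ext^i_{A^op}(k_A, A)` is
one-dimensional if `i = n` and zero otherwise. -/
def RightArtinSchelterCondition (n : ℕ) : Prop :=
  ∀ i : ℕ, Module.rank k (RightExt ε i) = if i = n then 1 else 0

/-- The category of left `R`-modules has finite global dimension. -/
def HasFiniteGlobalDimension (R : Type u) [Ring R] : Prop :=
  ∃ m : ℕ, ∀ M : ModuleCat.{u} R, HasProjectiveDimensionLE M m

/-- Right Artin–Schelter regularity with dimension `n`: the right Artin–Schelter condition holds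
with dimension `n`, the injective dimensions of the left module `A` and of the right module `A`
are finite and equal, and the global dimensions (on both sides) are finite. -/
structure IsRightArtinSchelterRegular (n : ℕ) : Prop where
  condition : RightArtinSchelterCondition ε n
  injectiveDimension_ne_top : injectiveDimension (ModuleCat.of A A) ≠ ⊤
  injectiveDimension_eq :
    injectiveDimension (ModuleCat.of A A) = injectiveDimension (ModuleCat.of Aᵐᵒᵖ A)
  left_global : HasFiniteGlobalDimension A
  right_global : HasFiniteGlobalDimension Aᵐᵒᵖ

/-- The algebra homomorphism `π : A → k` is the right homological integral (in dimension `n`):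
the left action on `Ext^n_{A^op}(k_A, A)` is `a • α = π(a) α`. -/
def IsRightHomologicalIntegral (n : ℕ) (π : A →ₐ[k] k) : Prop :=
  ∀ (a : A) (α : RightExt ε n), a • α = π a • α

end ArtinSchelter

/-! ### Hopf algebras -/

section Hopf

variable (k : Type u) {H : Type u} [Field k] [Ring H] [HopfAlgebra k H]

variable (H) in
/-- The square `S²` of the antipode, which is an algebra endomorphism. -/
def antipodeSq : H →ₐ[k] H :=
  AlgHom.ofLinearMap (HopfAlgebra.antipode k ∘ₗ HopfAlgebra.antipode k)
    (by simp)
    (by intro x y; simp [HopfAlgebra.antipode_mul_antidistrib])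

variable {k} in
/-- The right winding endomorphism `Ξ^r_π : h ↦ h₁ π(h₂)` of an algebra homomorphism
`π : H → k`. -/
def rightWinding (π : H →ₐ[k] k) : H →ₐ[k] H :=
  (Algebra.TensorProduct.rid k k H).toAlgHom.comp
    ((Algebra.TensorProduct.map (AlgHom.id k H) π).comp (Bialgebra.comulAlgHom k H))

end Hopf

end

end HopfDuality

/-!
The heart of the matter is an isomorphism `H ⊗ Ext^i_{Hᵐᵒᵖ}(k, H) ≃ Ext^i_{H^e}(H, H^e)` in every
degree `i`, with an explicit formula for the bimodule structure.

The algebra homomorphism `adjHom : Hᵐᵒᵖ → H^e`, `h ↦ S(h₁) ⊗ op h₂`, turns bimodules into right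
modules with the adjoint action. Restriction along it is exact and has the exact left adjoint
`Y ↦ H ⊗ Y`, which sends the trivial module `k` to the bimodule `H`. Hence it preserves injective
objects, and `Ext^i_{H^e}(H, N) ≃ Ext^i_{Hᵐᵒᵖ}(k, N)` for every bimodule `N` by dimension shifting
(`extRestrict_bijective`). For `N = H^e` the element `x ⊗ op a` equals `Σ adjHom(a₂)(S²(a₁)x ⊗ 1)`
(`sum_adjHom_mul_lft`), so the right module `H^e` is free on any basis of `H`. This is where `S²`
comes from, and invertibility of `S` is not needed: `S` and `S²` are convolution inverse to each
other as maps from `H` to `Hᵐᵒᵖ`. Since `H` has a resolution by finitely generated projective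
bimodules, `Ext` commutes with this possibly infinite direct sum, and the resulting map
`H ⊗ Ext^i_{Hᵐᵒᵖ}(k, H) → Ext^i_{H^e}(H, H^e)` is bijective (`dualHom_bijective`). The inner
bimodule structure reads `a (z ⊗ α) b = Σ S²(a₁) z b ⊗ a₂ α` (`smul_dualPair`).

Outside degree `d` this gives `Ext^i_{Hᵐᵒᵖ}(k, H) = 0`. In degree `d`, put
`E = Ext^d_{Hᵐᵒᵖ}(k, H)` and `U = Ext^d_{H^e}(H, H^e)`, and let `U ⊗_H V ≃ H`. As a right module
`U` is `H ⊗ E`, so that `U ⊗_H V ⊗_H k ≃ E ⊗ (V ⊗_H k)` is one-dimensional, and therefore so is `E`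
(`rank_eq_one_of_tensorIsoRegular`). The character `π` by which `H` acts on
the line `E` is the homological integral, and the formula for the bimodule structure says that `U`
is `H` twisted on the left by `σ = S² ∘ Ξ_π`. Such a twist is invertible only if `σ` is bijective
(`bijective_of_isInvertibleBimodule`). As winding endomorphisms are bijective, `S` is bijective.

For the global dimensions, the trivial module has finite projective dimension because `H` has,
tensoring with a right module `M` diagonally is exact and preserves projective modules, and
`M ⊗ k ≃ M`. This bounds the right global dimension, and the antipode, now an isomorphism of `H`
with its opposite, transports the bound to the left and identifies the two injective dimensions.
-/

namespace HopfDuality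

noncomputable section

/-! ### Twisting a tensor product by a coalgebra, and the adjoint embedding -/

section

open Coalgebra HopfAlgebra WithConv

section Twist

variable {k B C M : Type*} [CommRing k] [Ring B] [Algebra k B] [AddCommGroup C] [Module k C]
  [Coalgebra k C] [AddCommGroup M] [Module k M] [Module B M] [IsScalarTower k B M]

/-- The bilinear map `(m, c) ↦ f(c) m`, for a linear map `f` with values in `Bᵐᵒᵖ`. -/
def opAct (f : C →ₗ[k] Bᵐᵒᵖ) : M →ₗ[k] C →ₗ[k] M :=
  LinearMap.flip ((Algebra.lsmul k k M).toLinearMap ∘ₗ (opLinearEquiv k).symm.toLinearMap ∘ₗ f)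

/-- The endomorphism `m ⊗ c ↦ f(c₁) m ⊗ c₂` of `M ⊗ C` attached to a linear map `f` from a
coalgebra `C` to an algebra `B` that acts on `M`. The values of `f` are taken in `Bᵐᵒᵖ` to make
convolution of maps correspond to composition in the order `twist g ∘ twist f = twist (f * g)`. -/
def twist (f : C →ₗ[k] Bᵐᵒᵖ) : M ⊗[k] C →ₗ[k] M ⊗[k] C :=
  (TensorProduct.lift (opAct f)).rTensor C ∘ₗ (TensorProduct.assoc k M C C).symm.toLinearMap ∘ₗ
    comul.lTensor M

theorem twist_tmul (f : C →ₗ[k] Bᵐᵒᵖ) (m : M) (c : C) {ι : Type*} (r : Repr k c ι) :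
    twist f (m ⊗ₜ[k] c) = ∑ i ∈ r.index, ((f (r.left i)).unop • m) ⊗ₜ r.right i := by
  simp [twist, ← r.eq, tmul_sum, opAct]

theorem twist_twist (f g : C →ₗ[k] Bᵐᵒᵖ) (x : M ⊗[k] C) :
    twist g (twist f x) = twist (toConv f * toConv g).ofConv x := by
  induction x with
  | zero => simp
  | add x y hx hy => simp only [map_add, hx, hy]
  | tmul m c =>
    -- Coassociativity, evaluated under `c₁ ⊗ c₂ ⊗ c₃ ↦ g(c₂) f(c₁) m ⊗ c₃`.
    have h := sum_tmul_tmul_eq (ℛ k c) (fun i => ℛ k ((ℛ k c).left i))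
      (fun i => ℛ k ((ℛ k c).right i))
    have h' := congrArg (TensorProduct.lift
      (LinearMap.rTensorHom C ∘ₗ (opAct (M := M) g) ∘ₗ opAct f m)) h
    simp only [map_sum, lift.tmul, LinearMap.comp_apply, LinearMap.coe_rTensorHom,
      LinearMap.rTensor_tmul] at h'
    rw [twist_tmul f m c (ℛ k c), map_sum, twist_tmul _ m c (ℛ k c)]
    calc _ = _ := Finset.sum_congr rfl fun i _ =>
          twist_tmul g _ _ (ℛ k ((ℛ k c).right i))
      _ = _ := h'.symm
      _ = _ := Finset.sum_congr rfl fun i _ => by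
          change _ = (((toConv f * toConv g) ((ℛ k c).left i)).unop • m) ⊗ₜ[k] _
          rw [(ℛ k ((ℛ k c).left i)).convMul_apply, Finset.unop_sum, Finset.sum_smul, sum_tmul]
          exact Finset.sum_congr rfl fun j _ => by
            rw [unop_mul, mul_smul]; rfl

theorem twist_one (x : M ⊗[k] C) : twist (1 : WithConv (C →ₗ[k] Bᵐᵒᵖ)).ofConv x = x := by
  induction x with
  | zero => simp
  | add x y hx hy => simp only [map_add, hx, hy]
  | tmul m c =>
    rw [twist_tmul _ _ _ (ℛ k c)]
    change ∑ i ∈ (ℛ k c).index, ((algebraMap k Bᵐᵒᵖ (counit (R := k) ((ℛ k c).left i))).unop •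
      m) ⊗ₜ[k] (ℛ k c).right i = m ⊗ₜ c
    conv_rhs => rw [← sum_counit_smul (ℛ k c), tmul_sum]
    exact Finset.sum_congr rfl fun i _ => by
      rw [MulOpposite.algebraMap_apply, unop_op, algebraMap_smul, smul_tmul]

/-- If `f` is convolution invertible then `twist f` is bijective. -/
def twistEquiv (f g : C →ₗ[k] Bᵐᵒᵖ) (hfg : toConv f * toConv g = 1)
    (hgf : toConv g * toConv f = 1) : M ⊗[k] C ≃ₗ[k] M ⊗[k] C :=
  LinearEquiv.ofLinearMap (twist f) (twist g)
    (LinearMap.ext fun x => by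
      rw [LinearMap.comp_apply, twist_twist, hgf, twist_one, LinearMap.id_apply])
    (LinearMap.ext fun x => by
      rw [LinearMap.comp_apply, twist_twist, hfg, twist_one, LinearMap.id_apply])

end Twist

section HopfAlgebra

variable {k H : Type u} [Field k] [Ring H] [HopfAlgebra k H]

variable (k H) in
/-- The antipode as a map to `Hᵐᵒᵖ`. Its convolution inverse is `opAntipodeSq`, whether or not `S`
is bijective. -/
def opAntipode : H →ₗ[k] Hᵐᵒᵖ := (opLinearEquiv k).toLinearMap ∘ₗ antipode k

variable (k H) in
/-- `S²` as a map to `Hᵐᵒᵖ`. -/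
def opAntipodeSq : H →ₗ[k] Hᵐᵒᵖ := (opLinearEquiv k).toLinearMap ∘ₗ antipode k ∘ₗ antipode k

/-- The antipode applied to `a₁ S(a₂) = ε(a)`: in `Hᵐᵒᵖ` the product `S²(a₂) S(a₁)` has its factors
in the order of the convolution. -/
theorem opAntipode_mul_opAntipodeSq :
    toConv (opAntipode k H) * toConv (opAntipodeSq k H) = 1 := by
  ext a
  have h := congrArg (opAntipode k H) (sum_mul_antipode_eq_smul (ℛ k a))
  rw [(ℛ k a).convMul_apply]
  simpa [opAntipode, opAntipodeSq, antipode_mul_antidistrib, Algebra.algebraMap_eq_smul_one,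
    LinearMap.convOne_apply] using h

theorem opAntipodeSq_mul_opAntipode :
    toConv (opAntipodeSq k H) * toConv (opAntipode k H) = 1 := by
  ext a
  have h := congrArg (opAntipode k H) (sum_antipode_mul_eq_smul (ℛ k a))
  rw [(ℛ k a).convMul_apply]
  simpa [opAntipode, opAntipodeSq, antipode_mul_antidistrib, Algebra.algebraMap_eq_smul_one,
    LinearMap.convOne_apply] using h

variable (k H) in
/-- The comultiplication of `H` as an algebra homomorphism of opposite algebras. -/
def comulOp : Hᵐᵒᵖ →ₐ[k] Hᵐᵒᵖ ⊗[k] Hᵐᵒᵖ :=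
  (Algebra.TensorProduct.opAlgEquiv k k H H).symm.toAlgHom.comp
    (AlgHom.op (Bialgebra.comulAlgHom k H))

theorem comulOp_op (a : H) {ι : Type*} (r : Repr k a ι) :
    comulOp k H (op a) = ∑ i ∈ r.index, op (r.left i) ⊗ₜ op (r.right i) := by
  simp [comulOp, ← r.eq]

variable (k H) in
/-- The antipode as an algebra homomorphism `Hᵐᵒᵖ → H`. -/
def antipodeOfOp : Hᵐᵒᵖ →ₐ[k] H :=
  AlgHom.opComm (antipodeAlgHomOp k H)

@[simp]
theorem antipodeOfOp_op (a : H) : antipodeOfOp k H (op a) = antipode k a := rfl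

variable (k H) in
/-- The algebra homomorphism `Hᵐᵒᵖ → H^e`, `h ↦ S(h₁) ⊗ op h₂`, through which an `H`-bimodule
becomes a right `H`-module with the adjoint action `x ↼ h = S(h₁) x h₂`. -/
def adjHom : Hᵐᵒᵖ →ₐ[k] Env k H :=
  (Algebra.TensorProduct.map (antipodeOfOp k H) (AlgHom.id k Hᵐᵒᵖ)).comp (comulOp k H)

theorem adjHom_op (a : H) {ι : Type*} (r : Repr k a ι) :
    adjHom k H (op a) = ∑ i ∈ r.index, antipode k (r.left i) ⊗ₜ op (r.right i) := by
  simp [adjHom, comulOp_op a r]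

variable (k H) in
/-- The algebra homomorphism `ε ⊗ id : H^e → Hᵐᵒᵖ`, a retraction of `adjHom`. -/
def envProj : Env k H →ₐ[k] Hᵐᵒᵖ :=
  Algebra.TensorProduct.lift ((Algebra.ofId k Hᵐᵒᵖ).comp (Bialgebra.counitAlgHom k H))
    (AlgHom.id k Hᵐᵒᵖ) (fun _ _ => Algebra.commutes (R := k) (A := Hᵐᵒᵖ) _ _)

theorem envProj_tmul (x : H) (y : Hᵐᵒᵖ) :
    envProj k H (x ⊗ₜ y) = counit (R := k) x • y := by
  refine (Algebra.TensorProduct.lift_tmul _ _ _ _ _).trans ?_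
  simp [Algebra.ofId_apply, Algebra.smul_def]

theorem envProj_adjHom (a : Hᵐᵒᵖ) : envProj k H (adjHom k H a) = a := by
  obtain ⟨a, rfl⟩ := op_surjective a
  rw [adjHom_op a (ℛ k a)]
  have := congrArg op (sum_counit_smul (ℛ k a))
  simpa [envProj_tmul] using this

/-- `1 ⊗ op b = Σ (b₁ ⊗ 1)(S(b₂) ⊗ op b₃)`. -/
theorem sum_lft_mul_adjHom (b : H) {ι : Type*} (r : Repr k b ι) :
    ∑ i ∈ r.index, (lft (r.left i) : Env k H) * adjHom k H (op (r.right i)) = rgt b := by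
  let inl : H →ₗ[k] Env k H := (Algebra.TensorProduct.includeLeft (S := k)).toLinearMap
  let inr : H →ₗ[k] Env k H :=
    (Algebra.TensorProduct.includeRight).toLinearMap ∘ₗ (opLinearEquiv k).toLinearMap
  -- In the convolution algebra `adjHom` is `(inl ∘ S) * inr`, and `inl ∘ S` is inverse to `inl`.
  have h1 : toConv ((adjHom k H).toLinearMap ∘ₗ (opLinearEquiv k).toLinearMap) =
      toConv (inl ∘ₗ antipode k) * toConv inr := by
    ext a
    rw [(ℛ k a).convMul_apply]
    simp [adjHom_op a (ℛ k a), inl, inr]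
  have h2 : toConv inl * toConv (inl ∘ₗ antipode k) = 1 := by
    ext a
    rw [(ℛ k a).convMul_apply]
    have := congrArg inl (sum_mul_antipode_eq_smul (ℛ k a))
    simpa [inl, LinearMap.convOne_apply, Algebra.algebraMap_eq_smul_one, smul_tmul',
      Algebra.TensorProduct.one_def] using this
  have h3 : toConv inl * toConv ((adjHom k H).toLinearMap ∘ₗ (opLinearEquiv k).toLinearMap) =
      toConv inr := by
    rw [h1]
    refine (mul_assoc (toConv inl) (toConv (inl ∘ₗ antipode k)) (toConv inr)).symm.trans ?_
    rw [h2]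
    exact one_mul (toConv inr)
  have h4 := congrArg (fun f : WithConv (H →ₗ[k] Env k H) => f b) h3
  simp only [r.convMul_apply] at h4
  exact h4

variable (k H) in
/-- `H^e` is a free left module over `Hᵐᵒᵖ` (through `adjHom`) on any basis of `H`: the map
`x ⊗ c ↦ adjHom(c) (x ⊗ 1) = S(c₁) x ⊗ op c₂` is bijective. -/
def envEquiv : H ⊗[k] H ≃ₗ[k] Env k H :=
  (twistEquiv (opAntipode k H) (opAntipodeSq k H) opAntipode_mul_opAntipodeSq
    opAntipodeSq_mul_opAntipode).trans
    (TensorProduct.congr (LinearEquiv.refl k H) (opLinearEquiv k))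

theorem envEquiv_tmul (x c : H) :
    envEquiv k H (x ⊗ₜ c) = adjHom k H (op c) * lft x := by
  change TensorProduct.congr (LinearEquiv.refl k H) (opLinearEquiv k)
    (twist (opAntipode k H) (x ⊗ₜ c)) = _
  rw [twist_tmul _ _ _ (ℛ k c), adjHom_op c (ℛ k c), Finset.sum_mul, map_sum]
  simp [opAntipode]

/-- `x ⊗ op a = Σ adjHom(a₂) (S²(a₁) x ⊗ 1)`. -/
theorem sum_adjHom_mul_lft (x a : H) {ι : Type*} (r : Repr k a ι) :
    ∑ i ∈ r.index, adjHom k H (op (r.right i)) *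
      lft (antipode k (antipode k (r.left i)) * x) = (x ⊗ₜ op a : Env k H) := by
  have h : twist (opAntipode k H) (twist (opAntipodeSq k H) (x ⊗ₜ[k] a)) = x ⊗ₜ a := by
    rw [twist_twist, opAntipodeSq_mul_opAntipode, twist_one]
  have h' := congrArg (TensorProduct.congr (LinearEquiv.refl k H) (opLinearEquiv k)) h
  rw [twist_tmul _ _ _ r, map_sum, map_sum] at h'
  refine Eq.trans (Finset.sum_congr rfl fun i _ => ?_) h'
  exact (envEquiv_tmul _ _).symm

/-- The linear winding map `h ↦ h₁ q(h₂)` of a linear form `q`. -/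
def winding (q : H →ₗ[k] k) : H →ₗ[k] H :=
  (toConv LinearMap.id * toConv (Algebra.linearMap k H ∘ₗ q)).ofConv

theorem winding_apply (q : H →ₗ[k] k) (a : H) {ι : Type*} (r : Repr k a ι) :
    winding q a = ∑ i ∈ r.index, q (r.right i) • r.left i := by
  refine (r.convMul_apply _ _).trans (Finset.sum_congr rfl fun i _ => ?_)
  simp [← Algebra.commutes, Algebra.smul_def]

/-- By coassociativity, winding endomorphisms compose by convolution of the linear forms, so those
of two inverse forms are inverse to each other. -/
theorem winding_winding (p q : H →ₗ[k] k) (hpq : toConv (Algebra.linearMap k H ∘ₗ p) *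
    toConv (Algebra.linearMap k H ∘ₗ q) = 1) (a : H) : winding p (winding q a) = a := by
  have h : toConv (winding p) * toConv (Algebra.linearMap k H ∘ₗ q) = toConv LinearMap.id := by
    refine (mul_assoc (toConv LinearMap.id) (toConv (Algebra.linearMap k H ∘ₗ p))
      (toConv (Algebra.linearMap k H ∘ₗ q))).trans ?_
    rw [hpq]
    exact mul_one (toConv LinearMap.id)
  have h' := congrArg (fun f : WithConv (H →ₗ[k] H) => f a) h
  refine Eq.trans ?_ h'
  rw [winding_apply q a (ℛ k a), map_sum]
  refine Eq.trans (Finset.sum_congr rfl fun i _ => ?_) ((ℛ k a).convMul_apply _ _).symm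
  rw [map_smul, Algebra.smul_def]
  exact Algebra.commutes _ _

theorem rightWinding_apply (π : H →ₐ[k] k) (a : H) {ι : Type*} (r : Repr k a ι) :
    rightWinding π a = ∑ i ∈ r.index, π (r.right i) • r.left i := by
  simp [rightWinding, ← r.eq]

/-- The right winding endomorphism by `π ∘ S` is inverse to the right winding endomorphism
by `π`. -/
theorem rightWinding_bijective (π : H →ₐ[k] k) : Function.Bijective (rightWinding π) := by
  have hw : ⇑(rightWinding π) = winding π.toLinearMap := funext fun a => by
    rw [rightWinding_apply π a (ℛ k a), winding_apply _ a (ℛ k a)]; rfl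
  rw [hw]
  refine Function.bijective_iff_has_inverse.2
    ⟨winding (π.toLinearMap ∘ₗ antipode k), winding_winding _ _ ?_, winding_winding _ _ ?_⟩
  · ext a
    rw [(ℛ k a).convMul_apply]
    have := congrArg (fun x => algebraMap k H (π x)) (sum_antipode_mul_eq_smul (ℛ k a))
    simpa [LinearMap.convOne_apply] using this
  · ext a
    rw [(ℛ k a).convMul_apply]
    have := congrArg (fun x => algebraMap k H (π x)) (sum_mul_antipode_eq_smul (ℛ k a))
    simpa [LinearMap.convOne_apply] using this

end HopfAlgebra

end

/-! ### Projective dimension and resolutions by finitely generated projective modules -/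

section

open Abelian Limits

section Homological

/-- An exact functor that preserves projective modules does not increase projective dimensions:
it maps the syzygies of `X` to syzygies of its image. -/
theorem hasProjectiveDimensionLT_obj {R S : Type u} [Ring R] [Ring S]
    (F : ModuleCat.{u} R ⥤ ModuleCat.{u} S) [F.Additive] [PreservesFiniteLimits F]
    [PreservesFiniteColimits F] [F.PreservesProjectiveObjects] (n : ℕ) (X : ModuleCat.{u} R)
    (hX : HasProjectiveDimensionLT X n) : HasProjectiveDimensionLT (F.obj X) n := by
  induction n generalizing X with
  | zero =>
    exact (F.map_isZero (isZero_of_hasProjectiveDimensionLT_zero X)).hasProjectiveDimensionLT_zero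
  | succ n ih =>
    let P : ProjectivePresentation X := Classical.arbitrary _
    let T := ShortComplex.mk _ _ (kernel.condition P.f)
    have hT : T.ShortExact := { exact := ShortComplex.exact_kernel P.f }
    have h2 : Projective T.X₂ := P.projective
    have h2' : Projective (T.map F).X₂ := Functor.PreservesProjectiveObjects.projective_obj h2
    cases n with
    | zero =>
      have : Projective X := projective_iff_hasProjectiveDimensionLT_one.2 hX
      exact projective_iff_hasProjectiveDimensionLT_one.1
        (Functor.PreservesProjectiveObjects.projective_obj this)
    | succ n =>
      exact ((hT.map_of_exact F).hasProjectiveDimensionLT_X₃_iff n h2').2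
        (ih _ ((hT.hasProjectiveDimensionLT_X₃_iff n h2).1 hX))

theorem restrictScalars_exact {R S : Type u} [Ring R] [Ring S] (f : R →+* S) :
    PreservesFiniteLimits (ModuleCat.restrictScalars.{u} f) ∧
      PreservesFiniteColimits (ModuleCat.restrictScalars.{u} f) :=
  ((Functor.exact_tfae (ModuleCat.restrictScalars.{u} f)).out 1 3).mp fun S h => by
    rw [ShortComplex.ShortExact.moduleCat_exact_iff_function_exact] at h ⊢
    exact h

variable {R : Type u} [Ring R]

/-- `X` has a resolution of length less than `n` by finitely generated projective modules,
expressed through successive syzygies. -/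
def HasFGResolutionLT : ℕ → ModuleCat.{u} R → Prop
  | 0, X => IsZero X
  | n + 1, X => ∃ (K P : ModuleCat.{u} R) (i : K ⟶ P) (q : P ⟶ X) (w : i ≫ q = 0),
      (ShortComplex.mk i q w).ShortExact ∧ Projective P ∧ Module.Finite R P ∧
        HasFGResolutionLT n K

theorem HasFGResolutionLT.hasProjectiveDimensionLT {n : ℕ} {X : ModuleCat.{u} R}
    (h : HasFGResolutionLT n X) : HasProjectiveDimensionLT X n := by
  induction n generalizing X with
  | zero => exact IsZero.hasProjectiveDimensionLT_zero h
  | succ n ih =>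
    obtain ⟨K, P, i, q, w, hS, hP, -, hK⟩ := h
    exact hS.hasProjectiveDimensionLT_X₃ n (ih hK) (by
      have : HasProjectiveDimensionLT P 1 := inferInstance
      exact hasProjectiveDimensionLT_of_ge P 1 (n + 1) (by omega))

/-- A bounded complex of finitely generated projective modules that is exact in positive degrees,
cut at the index `j`, resolves the cokernel `Y` of its differential into degree `j`. -/
theorem hasFGResolutionLT_of_surjective (C : ChainComplex (ModuleCat.{u} R) ℕ)
    (hproj : ∀ i, Projective (C.X i)) (hfin : ∀ i, Module.Finite R (C.X i))
    (hex : ∀ j, C.ExactAt (j + 1)) (n j : ℕ) (hz : ∀ i, j + n ≤ i → IsZero (C.X i))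
    (Y : ModuleCat.{u} R) (q : C.X j ⟶ Y) (hq : Function.Surjective q)
    (hqe : Function.Exact (C.d (j + 1) j) q) : HasFGResolutionLT n Y := by
  induction n generalizing j Y with
  | zero =>
    have := hz j (by omega)
    rw [ModuleCat.isZero_iff_subsingleton] at this
    exact (ModuleCat.isZero_iff_subsingleton).2 hq.subsingleton
  | succ n ih =>
    let K : ModuleCat.{u} R := ModuleCat.of R (LinearMap.ker q.hom)
    refine ⟨K, C.X j, ModuleCat.ofHom (LinearMap.ker q.hom).subtype, q, ?_, ?_, hproj j, hfin j,
      ?_⟩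
    · ext x; exact x.2
    · exact ModuleCat.shortComplex_shortExact _ (fun y => ⟨fun h => ⟨⟨y, h⟩, rfl⟩, by
        rintro ⟨x, rfl⟩; exact x.2⟩) Subtype.val_injective hq
    · have hd : ∀ x, C.d (j + 1) j x ∈ LinearMap.ker q.hom := fun x => hqe.apply_apply_eq_zero x
      refine ih (j + 1) (fun i hi => hz i (by omega)) K
        (ModuleCat.ofHom ((C.d (j + 1) j).hom.codRestrict _ hd)) ?_ ?_
      · rintro ⟨y, hy⟩
        obtain ⟨x, hx⟩ := (hqe y).1 hy
        exact ⟨x, Subtype.ext hx⟩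
      · have h := hex j
        rw [HomologicalComplex.exactAt_iff' C (j + 2) (j + 1) j (by simp) (by simp),
          ShortComplex.ShortExact.moduleCat_exact_iff_function_exact] at h
        intro x
        exact Subtype.ext_iff.trans (h x)

theorem HasFiniteFGProjectiveResolution.hasFGResolutionLT {X : ModuleCat.{u} R}
    (h : HasFiniteFGProjectiveResolution X) : ∃ n, HasFGResolutionLT n X := by
  obtain ⟨P, hfin, m, hm⟩ := h
  refine ⟨m + 1, hasFGResolutionLT_of_surjective P.complex P.projective hfin
    P.complex_exactAt_succ (m + 1) 0 (fun i hi => hm i (by omega)) X (P.π.f 0) ?_ ?_⟩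
  · have : Epi (P.π.f 0) := inferInstance
    exact (ModuleCat.epi_iff_surjective (P.π.f 0)).1 this
  · have := P.exact₀
    rw [ShortComplex.ShortExact.moduleCat_exact_iff_function_exact] at this
    exact this

/-- `Ext` out of a module with a resolution by finitely generated projective modules commutes
with filtered unions, in the following form: if a family of endomorphisms of `N` eventually fixes
every element of `N`, then it eventually fixes every class in `Ext^i(X, N)`. -/
theorem HasFGResolutionLT.eventually_comp_eq {ι : Type*} {l : Filter ι} {N : ModuleCat.{u} R}
    (e : ι → (N ⟶ N)) (he : ∀ x : N, ∀ᶠ s in l, e s x = x) {n : ℕ} {X : ModuleCat.{u} R}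
    (h : HasFGResolutionLT n X) {i : ℕ} (β : Ext.{u} X N i) :
    ∀ᶠ s in l, β.comp (Ext.mk₀ (e s)) (add_zero i) = β := by
  induction n generalizing X i with
  | zero =>
    have := h.hasProjectiveDimensionLT
    refine Filter.Eventually.of_forall fun s => ?_
    rw [Ext.eq_zero_of_hasProjectiveDimensionLT β 0 (Nat.zero_le i), Ext.zero_comp]
  | succ n ih =>
    obtain ⟨K, P, j, q, w, hS, hP, hfin, hK⟩ := h
    have hq : Function.Surjective q := hS.moduleCat_surjective_g
    cases i with
    | zero =>
      obtain ⟨f, rfl⟩ := (Ext.mk₀_bijective X N).2 β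
      obtain ⟨t, ht⟩ := hfin.fg_top
      have : ∀ᶠ s in l, ∀ x ∈ t, e s (f (q x)) = f (q x) :=
        (Filter.eventually_all_finset t).2 fun x _ => he _
      filter_upwards [this] with s hs
      rw [Ext.mk₀_comp_mk₀]
      congr 1
      have : q ≫ f ≫ e s = q ≫ f := by
        apply ModuleCat.hom_ext
        exact LinearMap.ext_on ht hs
      have hepi : Epi q := hS.epi_g
      exact (cancel_epi q).1 this
    | succ i =>
      -- `β` is the image of a class `γ` on the syzygy under the connecting map, which commutes with
      -- composition on the side of `N`.
      obtain ⟨γ, rfl⟩ := Ext.contravariant_sequence_exact₃ hS N β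
        (Ext.eq_zero_of_projective _) (add_comm 1 i)
      filter_upwards [ih hK γ] with s hs
      rw [Ext.comp_assoc_of_third_deg_zero, hs]

end Homological

end

/-! ### The adjoint restriction of bimodules and its left adjoint -/

section

open Coalgebra HopfAlgebra Abelian Limits

section Diagonal

theorem endTensorEndAlgHom_tmul_tmul {k M N : Type*} [CommRing k] [AddCommGroup M] [Module k M]
    [AddCommGroup N] [Module k N] (f : Module.End k M) (g : Module.End k N) (m : M) (n : N) :
    Module.endTensorEndAlgHom (R := k) (S := k) (A := k) (f ⊗ₜ[k] g) (m ⊗ₜ[k] n) = f m ⊗ₜ g n :=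
  rfl

variable (k H : Type u) [Field k] [Ring H] [HopfAlgebra k H]

section
variable (M Y : Type u) [AddCommGroup M] [Module k M] [Module Hᵐᵒᵖ M]
  [IsScalarTower k Hᵐᵒᵖ M] [AddCommGroup Y] [Module k Y] [Module Hᵐᵒᵖ Y] [IsScalarTower k Hᵐᵒᵖ Y]

/-- The diagonal right action of `H` on the tensor product of two right `H`-modules,
`(m ⊗ y) · h = m h₁ ⊗ y h₂`. -/
def diagAction : Hᵐᵒᵖ →ₐ[k] Module.End k (M ⊗[k] Y) :=
  ((Module.endTensorEndAlgHom (R := k) (S := k) (A := k) (M := M) (N := Y)).comp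
    (Algebra.TensorProduct.map (Algebra.lsmul k k M) (Algebra.lsmul k k Y))).comp (comulOp k H)

variable {M Y} in
theorem diagAction_tmul (a : H) {ι : Type*} (r : Repr k a ι) (m : M) (y : Y) :
    diagAction k H M Y (op a) (m ⊗ₜ y) =
      ∑ i ∈ r.index, (op (r.left i) • m) ⊗ₜ (op (r.right i) • y) := by
  simp [diagAction, comulOp_op a r, endTensorEndAlgHom_tmul_tmul]

/-- The bimodule `H ⊗ Y` induced by a right `H`-module `Y`, with
`a · (x ⊗ y) · b = a x b₁ ⊗ y b₂`, as an action of `H^e`. -/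
def inducedAction : Env k H →ₐ[k] Module.End k (H ⊗[k] Y) :=
  Algebra.TensorProduct.lift
    ((Module.endTensorEndAlgHom (R := k) (S := k) (A := k) (M := H) (N := Y)).comp
      (Algebra.TensorProduct.includeLeft.comp (Algebra.lmul k H)))
    (diagAction k H H Y)
    (fun a b => by
      obtain ⟨b, rfl⟩ := op_surjective b
      refine LinearMap.ext fun t => ?_
      induction t with
      | zero => simp
      | add x y hx hy => rw [map_add, map_add, hx, hy]
      | tmul x y =>
        simp [diagAction_tmul k H b (ℛ k b), mul_assoc, endTensorEndAlgHom_tmul_tmul])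

variable {Y} in
theorem inducedAction_tmul (a b : H) {ι : Type*} (r : Repr k b ι) (x : H) (y : Y) :
    inducedAction k H Y (a ⊗ₜ op b) (x ⊗ₜ y) =
      ∑ i ∈ r.index, (a * x * r.left i) ⊗ₜ (op (r.right i) • y) := by
  have h : inducedAction k H Y (a ⊗ₜ op b) = _ := Algebra.TensorProduct.lift_tmul _ _ _ _ _
  rw [h, Module.End.mul_apply, diagAction_tmul k H b r]
  simp [mul_assoc, endTensorEndAlgHom_tmul_tmul]

end

variable {k H}

/-- The restriction of bimodules to right modules along `adjHom`. -/
abbrev adjRestrict (k H : Type u) [Field k] [Ring H] [HopfAlgebra k H] :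
    ModuleCat.{u} (Env k H) ⥤ ModuleCat.{u} Hᵐᵒᵖ :=
  ModuleCat.restrictScalars.{u} (adjHom k H).toRingHom

instance : PreservesFiniteLimits (adjRestrict k H) := (restrictScalars_exact _).1

instance : PreservesFiniteColimits (adjRestrict k H) := (restrictScalars_exact _).2

variable (k H) in
/-- The `H`-bimodule `H ⊗ Y` induced by a right `H`-module `Y`. It is a type synonym of `H ⊗ Y` that
carries the action `inducedAction` of `H^e`. -/
def Induced (Y : Type u) [AddCommGroup Y] [Module k Y] : Type u := H ⊗[k] Y

section Induced

variable (Y : Type u) [AddCommGroup Y] [Module k Y] [Module Hᵐᵒᵖ Y] [IsScalarTower k Hᵐᵒᵖ Y]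

instance : AddCommGroup (Induced k H Y) := inferInstanceAs (AddCommGroup (H ⊗[k] Y))

instance : Module (Env k H) (Induced k H Y) :=
  letI : Module (Module.End k (H ⊗[k] Y)) (Induced k H Y) :=
    inferInstanceAs (Module (Module.End k (H ⊗[k] Y)) (H ⊗[k] Y))
  Module.compHom (Induced k H Y) (inducedAction k H Y).toRingHom

variable {Y}

/-- The bimodule map `H ⊗ Y → H ⊗ Z`, `x ⊗ y ↦ x ⊗ f(y)`, induced by a map `f` of right modules. -/
def inducedMap {Z : Type u} [AddCommGroup Z] [Module k Z] [Module Hᵐᵒᵖ Z]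
    [IsScalarTower k Hᵐᵒᵖ Z] (f : Y →ₗ[Hᵐᵒᵖ] Z) : Induced k H Y →ₗ[Env k H] Induced k H Z where
  toFun := (f.restrictScalars k).lTensor H
  map_add' := map_add _
  map_smul' := by
    change ∀ (r : Env k H) (t : H ⊗[k] Y), (f.restrictScalars k).lTensor H
      (inducedAction k H Y r t) = inducedAction k H Z r ((f.restrictScalars k).lTensor H t)
    intro r t
    induction r using TensorProduct.induction_on with
    | zero => simp
    | add r s hr hs => simp only [map_add, LinearMap.add_apply, hr, hs]
    | tmul a b =>
      obtain ⟨b, rfl⟩ := op_surjective b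
      induction t using TensorProduct.induction_on with
      | zero => simp only [map_zero]
      | add t s ht hs => simp only [map_add, ht, hs]
      | tmul x y =>
        rw [inducedAction_tmul k H a b (ℛ k b), LinearMap.lTensor_tmul,
          inducedAction_tmul k H a b (ℛ k b), map_sum]
        simp

/-- The universal property of the induced bimodule: a map from `Y` to a bimodule `N` that is
linear for the adjoint right action on `N` extends to a bimodule map `x ⊗ y ↦ x g(y)`. -/
theorem exists_inducedLift {N : Type u} [AddCommGroup N] [Module k N] [Module (Env k H) N]
    [IsScalarTower k (Env k H) N] (g : Y →ₗ[k] N)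
    (hg : ∀ (a : H) (y : Y), g (op a • y) = adjHom k H (op a) • g y) :
    ∃ G : Induced k H Y →ₗ[Env k H] N, ∀ (x : H) (y : Y),
      G (x ⊗ₜ[k] y : H ⊗[k] Y) = (lft x : Env k H) • g y := by
  let G₀ : H ⊗[k] Y →ₗ[k] N := TensorProduct.lift
    ((LinearMap.lcomp k N g ∘ₗ (Algebra.lsmul k k N).toLinearMap ∘ₗ
      (Algebra.TensorProduct.includeLeft : H →ₐ[k] Env k H).toLinearMap))
  have hG₀ : ∀ x y, G₀ (x ⊗ₜ y) = (lft x : Env k H) • g y := fun x y => rfl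
  suffices h : ∀ (r : Env k H) (t : H ⊗[k] Y), G₀ (inducedAction k H Y r t) = r • G₀ t from
    ⟨{ toFun := G₀, map_add' := map_add G₀, map_smul' := h }, hG₀⟩
  intro r t
  induction r using TensorProduct.induction_on with
  | zero =>
    rw [map_zero]
    exact (map_zero G₀).trans (zero_smul (Env k H) (G₀ t)).symm
  | add r s hr hs => simp only [map_add, LinearMap.add_apply, hr, hs, add_smul]
  | tmul a b =>
    obtain ⟨b, rfl⟩ := op_surjective b
    induction t using TensorProduct.induction_on with
    | zero => simp only [map_zero, smul_zero]
    | add t s ht hs => simp only [map_add, ht, hs, smul_add]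
    | tmul x y =>
      rw [inducedAction_tmul k H a b (ℛ k b), map_sum, hG₀]
      have h : (a ⊗ₜ op b : Env k H) * lft x = lft (a * x) * rgt b := by simp
      rw [← mul_smul, h, ← sum_lft_mul_adjHom b (ℛ k b), Finset.mul_sum, Finset.sum_smul]
      refine Finset.sum_congr rfl fun i _ => ?_
      rw [hG₀, hg, ← mul_smul, ← mul_assoc]
      congr 2
      simp

/-- The unit `y ↦ 1 ⊗ y` of induction along `adjHom` is linear, since
`S(a₁) a₂ ⊗ y a₃ = 1 ⊗ y a`. -/
theorem adjHom_smul_one_tmul (a : H) (y : Y) :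
    adjHom k H (op a) • (show Induced k H Y from (1 ⊗ₜ[k] y : H ⊗[k] Y)) =
      (1 ⊗ₜ[k] (op a • y) : H ⊗[k] Y) := by
  let φ : H →ₗ[k] Y := (Algebra.lsmul k k Y).toLinearMap.flip y ∘ₗ (opLinearEquiv k).toLinearMap
  let K : H ⊗[k] (H ⊗[k] H) →ₗ[k] H ⊗[k] Y :=
    TensorProduct.map (LinearMap.mul' k H ∘ₗ (antipode k).rTensor H) φ ∘ₗ
      (TensorProduct.assoc k H H H).symm.toLinearMap
  have hK : ∀ p q r, K (p ⊗ₜ (q ⊗ₜ r)) = (antipode k p * q) ⊗ₜ (op r • y) := fun p q r => by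
    simp [K, φ]
  have h := congrArg K (sum_tmul_tmul_eq (ℛ k a) (fun i => ℛ k ((ℛ k a).left i))
      (fun i => ℛ k ((ℛ k a).right i)))
  simp only [map_sum, hK] at h
  change inducedAction k H Y (adjHom k H (op a)) (1 ⊗ₜ[k] y) = _
  rw [adjHom_op a (ℛ k a), map_sum, LinearMap.sum_apply]
  calc _ = _ := Finset.sum_congr rfl fun i _ => inducedAction_tmul k H _ _ (ℛ k _) _ _
    _ = _ := by simpa only [mul_one] using h.symm
    _ = _ := Finset.sum_congr rfl fun i _ => by
        rw [← sum_tmul, sum_antipode_mul_eq_smul, smul_tmul]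
    _ = _ := by
        rw [← tmul_sum]
        conv_rhs => rw [← sum_counit_smul (ℛ k a)]
        simp [Finset.sum_smul]

end Induced

/-- Restriction along `adjHom` preserves injective modules, because its left adjoint `Y ↦ H ⊗ Y`
preserves injective maps. -/
theorem injective_adjRestrict (N : ModuleCat.{u} (Env k H)) [hN : Injective N] :
    Injective ((adjRestrict k H).obj N) where
  factors {X Y} g f hf := by
    let i1 : Module k X := Module.compHom X (algebraMap k Hᵐᵒᵖ)
    let i2 : Module k Y := Module.compHom Y (algebraMap k Hᵐᵒᵖ)
    let i3 : Module k N := Module.compHom N (algebraMap k (Env k H))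
    have t1 : IsScalarTower k Hᵐᵒᵖ X := IsScalarTower.of_algebraMap_smul fun _ _ => rfl
    have t2 : IsScalarTower k Hᵐᵒᵖ Y := IsScalarTower.of_algebraMap_smul fun _ _ => rfl
    have t3 : IsScalarTower k (Env k H) N :=
      ⟨fun c r x => (congrArg (· • x) (Algebra.smul_def c r)).trans (mul_smul _ _ _)⟩
    have hg : ∀ (a : Hᵐᵒᵖ) (x : X), (show N from g (a • x)) =
        adjHom k H a • (show N from g x) := fun a x => g.hom.map_smul a x
    let g₀ : X →ₗ[k] N :=
      { toFun := g
        map_add' := g.hom.map_add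
        map_smul' := fun c x => by
          have := hg (algebraMap k Hᵐᵒᵖ c) x
          rw [AlgHom.commutes] at this
          exact this }
    -- Extend `g` to a bimodule map on `H ⊗ X`, then to `H ⊗ Y` by injectivity of `N`, and restrict
    -- the result to `1 ⊗ Y`.
    obtain ⟨G, hG⟩ := exists_inducedLift g₀ (fun a x => hg (op a) x)
    have hinj : Function.Injective (inducedMap (k := k) f.hom) :=
      Module.Flat.lTensor_preserves_injective_linearMap (M := H) (f.hom.restrictScalars k)
        ((ModuleCat.mono_iff_injective f).1 hf)
    have hmono : Mono (ModuleCat.ofHom (inducedMap (k := k) f.hom)) :=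
      (ModuleCat.mono_iff_injective _).2 hinj
    obtain ⟨E, hE⟩ := hN.factors (ModuleCat.ofHom G) (ModuleCat.ofHom (inducedMap (k := k) f.hom))
    let h₀ : Y →+ N :=
      { toFun := fun y => E (1 ⊗ₜ[k] y : H ⊗[k] Y)
        map_zero' := by rw [tmul_zero]; exact E.hom.map_zero
        map_add' := fun y z => by rw [tmul_add]; exact E.hom.map_add _ _ }
    have hh : ∀ (a : Hᵐᵒᵖ) (y : Y), h₀ (a • y) = adjHom k H a • h₀ y := fun a y => by
      obtain ⟨a, rfl⟩ := op_surjective a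
      refine Eq.trans (congrArg E ?_) (E.hom.map_smul (adjHom k H (op a))
        (1 ⊗ₜ[k] y : H ⊗[k] Y))
      exact (adjHom_smul_one_tmul a y).symm
    let h : Y ⟶ (adjRestrict k H).obj N := ModuleCat.ofHom (Y := (adjRestrict k H).obj N)
      { toFun := h₀, map_add' := h₀.map_add, map_smul' := hh }
    refine ⟨h, ?_⟩
    ext x
    have h1 := congrArg (fun φ => φ.hom (1 ⊗ₜ[k] x : H ⊗[k] X)) hE
    have h2 := hG 1 x
    exact h1.trans (h2.trans (one_smul (Env k H) (g₀ x)))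

end Diagonal

end

/-! ### Comparison of the cohomology of the regular bimodule and of the trivial module -/

section

open Coalgebra HopfAlgebra Abelian Limits

section AdjointExt

variable {k H : Type u} [Field k] [Ring H] [HopfAlgebra k H]

theorem sum_counit_right_smul (a : H) {ι : Type*} (r : Repr k a ι) :
    ∑ i ∈ r.index, counit (R := k) (r.right i) • r.left i = a := by
  have h := congrArg (TensorProduct.rid k H) (sum_tmul_counit_eq r)
  rw [map_sum] at h
  simpa only [TensorProduct.rid_tmul, one_smul] using h

/-- Linearity over `H^e` can be checked on pure tensors. -/
theorem map_env_smul {M N : Type*} [AddCommGroup M] [Module (Env k H) M] [AddCommGroup N]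
    [Module (Env k H) N] (f : M →+ N)
    (hf : ∀ (a b : H) (x : M), f ((a ⊗ₜ[k] op b : Env k H) • x) = (a ⊗ₜ[k] op b : Env k H) • f x)
    (r : Env k H) (x : M) : f (r • x) = r • f x := by
  induction r using TensorProduct.induction_on with
  | zero =>
    exact (congrArg f (zero_smul (Env k H) x)).trans
      ((map_zero f).trans (zero_smul (Env k H) (f x)).symm)
  | add r s hr hs =>
    exact (congrArg f (add_smul (r : Env k H) s x)).trans ((map_add f _ _).trans
      ((congrArg₂ (· + ·) hr hs).trans (add_smul (r : Env k H) s (f x)).symm))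
  | tmul a b => exact hf a (unop b) x

theorem tmul_op_mul_lft (a b x : H) :
    (a ⊗ₜ op b : Env k H) * lft x = lft (a * x) * rgt b := by simp

theorem trivialRight_smul (a : H) (c : k) :
    op a • (show trivialRight (Bialgebra.counitAlgHom k H) from c) =
      (show trivialRight (Bialgebra.counitAlgHom k H) from counit (R := k) a * c) := rfl

/-- Scalars span a trivial right module for the adjoint action: `S(a₁) c a₂ = ε(a) c`. -/
theorem adjHom_smul_regularBimodule (a : H) (c : k) :
    adjHom k H (op a) • (show regularBimodule k H from algebraMap k H c) =
      (show regularBimodule k H from algebraMap k H (counit (R := k) a * c)) := by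
  rw [adjHom_op a (ℛ k a), Finset.sum_smul]
  change ∑ i ∈ (ℛ k a).index, antipode k ((ℛ k a).left i) *
    (algebraMap k H c * (ℛ k a).right i) = (algebraMap k H (counit (R := k) a * c) : H)
  simp_rw [Algebra.left_comm]
  rw [← Finset.mul_sum, sum_antipode_mul_eq_algebraMap_counit, ← map_mul, mul_comm]

variable (k H) in
/-- The unit `k → H` is linear for the adjoint right action on `H`. -/
def augUnit : trivialRight (Bialgebra.counitAlgHom k H) ⟶
    (adjRestrict k H).obj (regularBimodule k H) :=
  ModuleCat.ofHom (X := trivialRight (Bialgebra.counitAlgHom k H))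
    (Y := (adjRestrict k H).obj (regularBimodule k H))
    { toFun := fun c : k => (algebraMap k H c : H)
      map_add' := fun x y => map_add (algebraMap k H) (show k from x) (show k from y)
      map_smul' := fun a c => by
        obtain ⟨a, rfl⟩ := op_surjective a
        exact (adjHom_smul_regularBimodule (k := k) a c).symm }

theorem regularBimodule_hom_apply {N : ModuleCat.{u} (Env k H)} (f : regularBimodule k H ⟶ N)
    (x : H) : f (show regularBimodule k H from x) =
      (lft x : Env k H) • f (show regularBimodule k H from (1 : H)) := by
  rw [← map_smul]
  refine congrArg f ?_
  change (x : H) = x * (1 * 1)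
  rw [mul_one, mul_one]

/-- Induction along `adjHom` sends the trivial right module to the regular bimodule: a bimodule map
`H ⟶ N` is the same as an element of `N` on which the adjoint right action is trivial. -/
theorem augUnit_comp_bijective (N : ModuleCat.{u} (Env k H)) :
    Function.Bijective
      (fun f : regularBimodule k H ⟶ N => augUnit k H ≫ (adjRestrict k H).map f) := by
  constructor
  · intro f f' h
    have h1 : f (show regularBimodule k H from algebraMap k H 1) =
        f' (show regularBimodule k H from algebraMap k H 1) :=
      congrArg (fun φ => φ (show trivialRight (Bialgebra.counitAlgHom k H) from (1 : k))) h
    rw [map_one] at h1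
    ext x
    exact (regularBimodule_hom_apply f x).trans
      ((congrArg _ h1).trans (regularBimodule_hom_apply f' x).symm)
  · intro g
    let n : N := g (show trivialRight (Bialgebra.counitAlgHom k H) from (1 : k))
    have hg : ∀ (a : Hᵐᵒᵖ) (c : trivialRight (Bialgebra.counitAlgHom k H)),
        (show N from g (a • c)) = adjHom k H a • (show N from g c) := fun a c => g.hom.map_smul a c
    have hc : ∀ c : k, (show N from g (show trivialRight (Bialgebra.counitAlgHom k H) from c)) =
        algebraMap k (Env k H) c • n := fun c => by
      have := hg (op (algebraMap k H c))
        (show trivialRight (Bialgebra.counitAlgHom k H) from (1 : k))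
      rw [trivialRight_smul, ← MulOpposite.algebraMap_apply, AlgHom.commutes] at this
      simpa using this
    have hn : ∀ b : H, adjHom k H (op b) • n = algebraMap k (Env k H) (counit (R := k) b) • n :=
      fun b => by
        rw [← hc, ← hg, trivialRight_smul, mul_one]
    -- The adjoint action on `n` is trivial, so `n` is central: `n b = b₁ (n ↼ b₂) = b n`.
    have hr : ∀ b : H, (rgt b : Env k H) • n = (lft b : Env k H) • n := fun b => by
      rw [← sum_lft_mul_adjHom b (ℛ k b), Finset.sum_smul]
      simp_rw [mul_smul, hn]
      simp_rw [← mul_smul, ← Finset.sum_smul]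
      congr 1
      simp_rw [← Algebra.commutes, ← Algebra.smul_def, lft, smul_tmul']
      rw [← sum_tmul, sum_counit_right_smul]
    let f₀ : regularBimodule k H →+ N :=
      { toFun := fun x : H => (lft x : Env k H) • n
        map_zero' := by
          change (lft (0 : H) : Env k H) • n = 0
          rw [lft, zero_tmul]
          exact zero_smul (Env k H) n
        map_add' := fun x y : H => by
          change (lft (x + y) : Env k H) • n = _
          rw [lft, add_tmul, add_smul] }
    let f : regularBimodule k H ⟶ N := ModuleCat.ofHom (X := regularBimodule k H)
      { toFun := f₀
        map_add' := f₀.map_add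
        map_smul' := map_env_smul f₀ fun a b (x : H) => by
          change (lft (a * (x * b)) : Env k H) • n =
            (a ⊗ₜ[k] op b : Env k H) • (lft x : Env k H) • n
          rw [← mul_smul, tmul_op_mul_lft, mul_smul, hr, ← mul_smul]
          simp [mul_assoc] }
    refine ⟨f, ?_⟩
    ext (c : k)
    refine Eq.trans ?_ (hc c).symm
    change (lft (algebraMap k H c) : Env k H) • n = _
    rfl

/-- The map `Ext^i_{H^e}(H, N) → Ext^i_{Hᵐᵒᵖ}(k, N)` given by restriction along `adjHom` and
composition with the unit `k → H`. -/
def extRestrict (N : ModuleCat.{u} (Env k H)) (i : ℕ) :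
    Ext.{u} (regularBimodule k H) N i →+
      Ext.{u} (trivialRight (Bialgebra.counitAlgHom k H)) ((adjRestrict k H).obj N) i :=
  ((Ext.mk₀ (augUnit k H)).precomp _ (zero_add i)).comp ((adjRestrict k H).mapExtAddHom _ N i)

theorem extRestrict_apply {N : ModuleCat.{u} (Env k H)} {i : ℕ}
    (α : Ext.{u} (regularBimodule k H) N i) : extRestrict N i α =
      (Ext.mk₀ (augUnit k H)).comp (α.mapExactFunctor (adjRestrict k H)) (zero_add i) := rfl

theorem extRestrict_mk₀ {N : ModuleCat.{u} (Env k H)} (f : regularBimodule k H ⟶ N) :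
    extRestrict N 0 (Ext.mk₀ f) = Ext.mk₀ (augUnit k H ≫ (adjRestrict k H).map f) := by
  rw [extRestrict_apply, Ext.mapExactFunctor_mk₀, Ext.mk₀_comp_mk₀]

theorem extRestrict_comp {N N' : ModuleCat.{u} (Env k H)} {i j l : ℕ}
    (α : Ext.{u} (regularBimodule k H) N i) (β : Ext.{u} N N' j) (h : i + j = l) :
    extRestrict N' l (α.comp β h) =
      (extRestrict N i α).comp (β.mapExactFunctor (adjRestrict k H)) h := by
  rw [extRestrict_apply, extRestrict_apply, Ext.mapExactFunctor_comp,
    Ext.comp_assoc _ _ _ (zero_add i) h (by omega)]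

attribute [local instance] Ext.subsingleton_of_injective in
/-- `Ext^i_{H^e}(H, N) ≃ Ext^i_{Hᵐᵒᵖ}(k, N)`, by shifting dimensions along an injective presentation
of `N`, which the adjoint restriction turns into an injective presentation. -/
theorem extRestrict_bijective (N : ModuleCat.{u} (Env k H)) (i : ℕ) :
    Function.Bijective (extRestrict N i) := by
  induction i generalizing N with
  | zero =>
    have h : extRestrict N 0 ∘ (Ext.mk₀ : (regularBimodule k H ⟶ N) → _) = Ext.mk₀ ∘
        (fun f : regularBimodule k H ⟶ N => augUnit k H ≫ (adjRestrict k H).map f) :=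
      funext extRestrict_mk₀
    refine (Function.Bijective.of_comp_iff _ (Ext.mk₀_bijective _ _)).1 ?_
    rw [h]
    exact (Ext.mk₀_bijective _ _).comp (augUnit_comp_bijective N)
  | succ n hn =>
    let I : InjectivePresentation N := Classical.arbitrary _
    let S := ShortComplex.mk _ _ (cokernel.condition I.f)
    have hI : Injective S.X₂ := I.injective
    have : Injective (S.map (adjRestrict k H)).X₂ := injective_adjRestrict S.X₂
    have hS : S.ShortExact := { exact := ShortComplex.exact_cokernel I.f }
    have hS' := hS.map_of_exact (adjRestrict k H)
    refine AddMonoidHom.bijective_of_surjective_of_bijective_of_right_exact _ _ _ _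
      (extRestrict S.X₂ n) (extRestrict S.X₃ n) (extRestrict S.X₁ (n + 1)) ?_ ?_
      ((ShortComplex.ab_exact_iff_function_exact _).mp
        (Ext.covariant_sequence_exact₃' (regularBimodule k H) hS n (n + 1) rfl))
      ((ShortComplex.ab_exact_iff_function_exact _).mp
        (Ext.covariant_sequence_exact₃' (trivialRight (Bialgebra.counitAlgHom k H)) hS' n
          (n + 1) rfl))
      (hn _).surjective (hn _)
      (fun x₁ ↦ Ext.covariant_sequence_exact₁ _ hS x₁ (by subsingleton) rfl)
      (fun y₁ ↦ Ext.covariant_sequence_exact₁ _ hS' y₁ (by subsingleton) rfl)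
    · ext α
      change _ = extRestrict S.X₃ n (α.comp (Ext.mk₀ S.g) (add_zero n))
      rw [extRestrict_comp, Ext.mapExactFunctor_mk₀]
      rfl
    · ext α
      change _ = extRestrict S.X₁ (n + 1) (α.comp hS.extClass rfl)
      rw [extRestrict_comp, Ext.mapExactFunctor_extClass]
      rfl

end AdjointExt

end

/-! ### The trivial module and diagonal tensor products -/

section

open Coalgebra HopfAlgebra Abelian Limits WithConv

section TrivialModule

variable {k H : Type u} [Field k] [Ring H] [HopfAlgebra k H]

/-- Restricting a right module along `ε ⊗ id : H^e → Hᵐᵒᵖ` and then along `adjHom` gives it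
back. -/
def envProjIso (Z : ModuleCat.{u} Hᵐᵒᵖ) : (adjRestrict k H).obj
    ((ModuleCat.restrictScalars.{u} (envProj k H).toRingHom).obj Z) ≅ Z :=
  let X := (adjRestrict k H).obj ((ModuleCat.restrictScalars.{u} (envProj k H).toRingHom).obj Z)
  let e : X ≃ₗ[Hᵐᵒᵖ] Z :=
    { toFun := fun x => x
      invFun := fun x => x
      left_inv := fun _ => rfl
      right_inv := fun _ => rfl
      map_add' := fun _ _ => rfl
      map_smul' := fun a x =>
        congrArg (fun b : Hᵐᵒᵖ => b • (show Z from x)) (envProj_adjHom a) }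
  e.toModuleIso

/-- Every right module is the adjoint restriction of a bimodule, so properties of `Ext(H, -)` over
`H^e` pass to `Ext(k, -)` over `Hᵐᵒᵖ`. -/
theorem exists_extRestrict_comp_eq {Z : ModuleCat.{u} Hᵐᵒᵖ} {i : ℕ}
    (β : Ext.{u} (trivialRight (Bialgebra.counitAlgHom k H)) Z i) :
    ∃ α, (extRestrict ((ModuleCat.restrictScalars.{u} (envProj k H).toRingHom).obj Z) i α).comp
      (Ext.mk₀ (envProjIso Z).hom) (add_zero i) = β := by
  obtain ⟨α, hα⟩ := (extRestrict_bijective _ i).2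
    (β.comp (Ext.mk₀ (envProjIso (k := k) Z).inv) (add_zero i))
  refine ⟨α, ?_⟩
  rw [hα, Ext.comp_assoc_of_third_deg_zero, Ext.mk₀_comp_mk₀, Iso.inv_hom_id, Ext.comp_mk₀_id]

theorem hasProjectiveDimensionLT_trivialRight {n : ℕ}
    (h : HasProjectiveDimensionLT (regularBimodule k H) n) :
    HasProjectiveDimensionLT (trivialRight (Bialgebra.counitAlgHom k H)) n := by
  rw [hasProjectiveDimensionLT_iff.{u}]
  intro i hi Z β
  obtain ⟨α, rfl⟩ := exists_extRestrict_comp_eq β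
  rw [Ext.eq_zero_of_hasProjectiveDimensionLT α n hi, map_zero, Ext.zero_comp]

/-- The trivial module inherits from the regular bimodule that `Ext` out of it commutes with
filtered unions, in the form of `HasFGResolutionLT.eventually_comp_eq`. -/
theorem eventually_trivialRight_comp_eq {ι : Type*} {l : Filter ι} {Z : ModuleCat.{u} Hᵐᵒᵖ}
    (e : ι → (Z ⟶ Z)) (he : ∀ x : Z, ∀ᶠ s in l, e s x = x) {n : ℕ}
    (h : HasFGResolutionLT n (regularBimodule k H)) {i : ℕ}
    (β : Ext.{u} (trivialRight (Bialgebra.counitAlgHom k H)) Z i) :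
    ∀ᶠ s in l, β.comp (Ext.mk₀ (e s)) (add_zero i) = β := by
  obtain ⟨α, rfl⟩ := exists_extRestrict_comp_eq β
  let P := ModuleCat.restrictScalars.{u} (envProj k H).toRingHom
  filter_upwards [h.eventually_comp_eq (N := P.obj Z) (fun s => P.map (e s)) he α] with s hs
  conv_rhs => rw [← hs, extRestrict_comp, Ext.mapExactFunctor_mk₀]
  rw [Ext.comp_assoc_of_third_deg_zero, Ext.comp_assoc_of_third_deg_zero, Ext.mk₀_comp_mk₀,
    Ext.mk₀_comp_mk₀]
  congr 1

end TrivialModule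

section DiagonalFunctor

variable (k H : Type u) [Field k] [Ring H] [HopfAlgebra k H]

variable {H} in
/-- The tensor product of two right `H`-modules, as a type synonym that carries the diagonal
action `diagAction`. -/
def DiagTensor (M Y : Type u) [AddCommGroup M] [Module k M] [AddCommGroup Y] [Module k Y] :
    Type u := M ⊗[k] Y

variable (M Y : Type u) [AddCommGroup M] [Module k M] [Module Hᵐᵒᵖ M] [IsScalarTower k Hᵐᵒᵖ M]
  [AddCommGroup Y] [Module k Y] [Module Hᵐᵒᵖ Y] [IsScalarTower k Hᵐᵒᵖ Y]

instance : AddCommGroup (DiagTensor k M Y) := inferInstanceAs (AddCommGroup (M ⊗[k] Y))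

instance : Module k (DiagTensor k M Y) := inferInstanceAs (Module k (M ⊗[k] Y))

instance : Module Hᵐᵒᵖ (DiagTensor k M Y) :=
  letI : Module (Module.End k (M ⊗[k] Y)) (DiagTensor k M Y) :=
    inferInstanceAs (Module (Module.End k (M ⊗[k] Y)) (M ⊗[k] Y))
  Module.compHom (DiagTensor k M Y) (diagAction k H M Y).toRingHom

instance : IsScalarTower k Hᵐᵒᵖ (DiagTensor k M Y) :=
  ⟨fun c a t => congrArg (fun f : Module.End k (M ⊗[k] Y) => f t)
    (map_smul (diagAction k H M Y) c a)⟩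

variable {M Y k H}

/-- The functoriality of `M ⊗ Y` in `Y`. -/
def diagMap {Z : Type u} [AddCommGroup Z] [Module k Z] [Module Hᵐᵒᵖ Z]
    [IsScalarTower k Hᵐᵒᵖ Z] (f : Y →ₗ[Hᵐᵒᵖ] Z) : DiagTensor k M Y →ₗ[Hᵐᵒᵖ] DiagTensor k M Z where
  toFun := (f.restrictScalars k).lTensor M
  map_add' := map_add _
  map_smul' := by
    change ∀ (a : Hᵐᵒᵖ) (t : M ⊗[k] Y), (f.restrictScalars k).lTensor M
      (diagAction k H M Y a t) = diagAction k H M Z a ((f.restrictScalars k).lTensor M t)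
    intro a t
    obtain ⟨a, rfl⟩ := op_surjective a
    induction t using TensorProduct.induction_on with
    | zero => simp only [map_zero]
    | add t s ht hs => simp only [map_add, ht, hs]
    | tmul x y =>
      rw [diagAction_tmul k H a (ℛ k a), LinearMap.lTensor_tmul,
        diagAction_tmul k H a (ℛ k a), map_sum]
      simp

/-- For a vector space `V`, the diagonal tensor product `M ⊗ (H ⊗ V)` is the free module on
`M ⊗ V`: the map `a ⊗ (m ⊗ v) ↦ (m ⊗ (1 ⊗ v)) · a` from the free module is bijective. -/
theorem projective_diagTensor_free (V : Type u) [AddCommGroup V] [Module k V] :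
    Module.Projective Hᵐᵒᵖ (DiagTensor k M (Hᵐᵒᵖ ⊗[k] V)) := by
  let j : M ⊗[k] V →ₗ[k] DiagTensor k M (Hᵐᵒᵖ ⊗[k] V) :=
    (TensorProduct.mk k Hᵐᵒᵖ V 1).lTensor M
  let Φ : Hᵐᵒᵖ ⊗[k] (M ⊗[k] V) →ₗ[Hᵐᵒᵖ] DiagTensor k M (Hᵐᵒᵖ ⊗[k] V) :=
    TensorProduct.AlgebraTensorModule.lift
      ((LinearMap.toSpanSingleton Hᵐᵒᵖ (M ⊗[k] V →ₗ[k] DiagTensor k M (Hᵐᵒᵖ ⊗[k] V)) j))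
  -- Up to reordering factors, `Φ` is `m ⊗ a ↦ m a₁ ⊗ a₂`, the twist by the identity of `H`, which
  -- is convolution inverse to `S`. As a right module `M` is acted on by `Hᵐᵒᵖ`, so `f` has values
  -- in `Hᵐᵒᵖᵐᵒᵖ`.
  let f : H →ₗ[k] Hᵐᵒᵖᵐᵒᵖ := (opLinearEquiv k).toLinearMap ∘ₗ (opLinearEquiv k).toLinearMap
  have hfg : toConv f * toConv (f ∘ₗ antipode k) = 1 := by
    ext a
    have h := congrArg f (sum_mul_antipode_eq_smul (ℛ k a))
    rw [(ℛ k a).convMul_apply]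
    simpa [f, Algebra.algebraMap_eq_smul_one, LinearMap.convOne_apply] using h
  have hgf : toConv (f ∘ₗ antipode k) * toConv f = 1 := by
    ext a
    have h := congrArg f (sum_antipode_mul_eq_smul (ℛ k a))
    rw [(ℛ k a).convMul_apply]
    simpa [f, Algebra.algebraMap_eq_smul_one, LinearMap.convOne_apply] using h
  let E : Hᵐᵒᵖ ⊗[k] (M ⊗[k] V) ≃ₗ[k] M ⊗[k] (Hᵐᵒᵖ ⊗[k] V) :=
    (TensorProduct.congr (opLinearEquiv k).symm (LinearEquiv.refl k _)).trans <|
    (TensorProduct.leftComm k H M V).trans <|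
    (TensorProduct.assoc k M H V).symm.trans <|
    (TensorProduct.congr (twistEquiv f (f ∘ₗ antipode k) hfg hgf) (LinearEquiv.refl k V)).trans <|
    (TensorProduct.assoc k M H V).trans <|
    TensorProduct.congr (LinearEquiv.refl k M)
      (TensorProduct.congr (opLinearEquiv k) (LinearEquiv.refl k V))
  have hE : ∀ t, Φ t = E t := by
    intro t
    induction t using TensorProduct.induction_on with
    | zero => rw [map_zero, map_zero]; rfl
    | add x y hx hy => rw [map_add, map_add, hx, hy]; rfl
    | tmul a t =>
      obtain ⟨a, rfl⟩ := op_surjective a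
      induction t using TensorProduct.induction_on with
      | zero => rw [tmul_zero, map_zero, map_zero]; rfl
      | add x y hx hy => rw [tmul_add, map_add, map_add, hx, hy]; rfl
      | tmul m v =>
        have h1 : Φ (op a ⊗ₜ (m ⊗ₜ v)) =
          diagAction k H M (Hᵐᵒᵖ ⊗[k] V) (op a) (m ⊗ₜ ((1 : Hᵐᵒᵖ) ⊗ₜ v)) := rfl
        have h2 : E (op a ⊗ₜ (m ⊗ₜ v)) = (TensorProduct.congr (LinearEquiv.refl k M)
          (TensorProduct.congr (opLinearEquiv k) (LinearEquiv.refl k V)))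
          (TensorProduct.assoc k M H V (twist f (m ⊗ₜ a) ⊗ₜ v)) := rfl
        rw [h1, h2, diagAction_tmul k H a (ℛ k a), twist_tmul f m a (ℛ k a), sum_tmul, map_sum,
          map_sum]
        simp [f, smul_tmul']
        rfl
  have hbij : Function.Bijective Φ := by
    have : ⇑Φ = ⇑E := funext hE
    rw [this]; exact E.bijective
  have : Module.Free Hᵐᵒᵖ (Hᵐᵒᵖ ⊗[k] (M ⊗[k] V)) := inferInstance
  exact Module.Projective.of_equiv (LinearEquiv.ofBijective Φ hbij)

/-- A projective `Y` is a retract of the free module `Hᵐᵒᵖ ⊗ Y`. -/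
theorem projective_diagTensor [hY : Module.Projective Hᵐᵒᵖ Y] :
    Module.Projective Hᵐᵒᵖ (DiagTensor k M Y) := by
  let μ : Hᵐᵒᵖ ⊗[k] Y →ₗ[Hᵐᵒᵖ] Y := TensorProduct.AlgebraTensorModule.lift
    (LinearMap.toSpanSingleton Hᵐᵒᵖ (Y →ₗ[k] Y) LinearMap.id)
  have hμ : ∀ a y, μ (a ⊗ₜ y) = a • y := fun a y => rfl
  obtain ⟨s, hs⟩ := Module.projective_lifting_property μ LinearMap.id
    (fun y => ⟨1 ⊗ₜ y, by rw [hμ, one_smul]⟩)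
  have := projective_diagTensor_free (k := k) (H := H) (M := M) Y
  refine Module.Projective.of_split (diagMap (k := k) (M := M) s) (diagMap (k := k) (M := M) μ) ?_
  refine LinearMap.ext fun (t : M ⊗[k] Y) => ?_
  change (μ.restrictScalars k).lTensor M ((s.restrictScalars k).lTensor M t) = t
  rw [← LinearMap.comp_apply, ← LinearMap.lTensor_comp]
  have : (μ.restrictScalars k) ∘ₗ (s.restrictScalars k) = LinearMap.id :=
    LinearMap.ext fun y => LinearMap.congr_fun hs y
  rw [this, LinearMap.lTensor_id, LinearMap.id_apply]

open ModuleCat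

/-- The functor `M ⊗ -` on right `H`-modules. -/
def diagFunctor (M : ModuleCat.{u} Hᵐᵒᵖ) : ModuleCat.{u} Hᵐᵒᵖ ⥤ ModuleCat.{u} Hᵐᵒᵖ where
  obj Y := ModuleCat.of Hᵐᵒᵖ (DiagTensor k M Y)
  map f := ModuleCat.ofHom (diagMap (k := k) (M := M) f.hom)
  map_id Y := by
    ext (t : M ⊗[k] Y)
    exact LinearMap.congr_fun (LinearMap.lTensor_id M Y) t
  map_comp {X Y Z} f g := by
    ext (t : M ⊗[k] X)
    exact LinearMap.congr_fun (LinearMap.lTensor_comp M (g.hom.restrictScalars k)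
      (f.hom.restrictScalars k)) t

end DiagonalFunctor

end

/-! ### Global and injective dimensions -/

section

open Coalgebra HopfAlgebra Abelian Limits ModuleCat

section GlobalDimension

variable {k H : Type u} [Field k] [Ring H] [HopfAlgebra k H]

instance (M : ModuleCat.{u} Hᵐᵒᵖ) : (diagFunctor (k := k) M).Additive where
  map_add {X Y f g} := by
    ext (t : M ⊗[k] X)
    exact LinearMap.congr_fun (LinearMap.lTensor_add M (f.hom.restrictScalars k)
      (g.hom.restrictScalars k)) t

theorem diagFunctor_exact (M : ModuleCat.{u} Hᵐᵒᵖ) :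
    PreservesFiniteLimits (diagFunctor (k := k) M) ∧
      PreservesFiniteColimits (diagFunctor (k := k) M) :=
  ((Functor.exact_tfae (diagFunctor (k := k) M)).out 1 3).mp fun S h => by
    rw [ShortComplex.ShortExact.moduleCat_exact_iff_function_exact] at h ⊢
    exact Module.Flat.lTensor_exact (R := k) M (f := S.f.hom.restrictScalars k)
      (g := S.g.hom.restrictScalars k) h

instance (M : ModuleCat.{u} Hᵐᵒᵖ) : PreservesFiniteLimits (diagFunctor (k := k) M) :=
  (diagFunctor_exact M).1

instance (M : ModuleCat.{u} Hᵐᵒᵖ) : PreservesFiniteColimits (diagFunctor (k := k) M) :=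
  (diagFunctor_exact M).2

instance (M : ModuleCat.{u} Hᵐᵒᵖ) : (diagFunctor (k := k) M).PreservesProjectiveObjects where
  projective_obj {X} hX := by
    have : Module.Projective Hᵐᵒᵖ X := (IsProjective.iff_projective X).2 hX
    exact (IsProjective.iff_projective _).1
      (projective_diagTensor (k := k) (H := H) (M := M) (Y := X))

theorem sum_counit_smul_smul (M : ModuleCat.{u} Hᵐᵒᵖ) (a : H) (m : M) (c : k) :
    ∑ i ∈ (ℛ k a).index, (counit (R := k) ((ℛ k a).right i) * c) • op ((ℛ k a).left i) • m =
      op a • c • m := by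
  have h : op a • c • m = c • op a • m := (Algebra.lsmul k k M (op a)).map_smul c m
  rw [h]
  conv_rhs => rw [← sum_counit_right_smul a (ℛ k a)]
  rw [Finset.op_sum, Finset.sum_smul, Finset.smul_sum]
  refine Finset.sum_congr rfl fun i _ => ?_
  rw [op_smul, smul_assoc, ← mul_smul, mul_comm]

/-- `M ⊗ k ≃ M` for the diagonal action. -/
def diagTrivialIso (M : ModuleCat.{u} Hᵐᵒᵖ) :
    (diagFunctor (k := k) M).obj (trivialRight (Bialgebra.counitAlgHom k H)) ≅ M := by
  let T := trivialRight (Bialgebra.counitAlgHom k H)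
  let τ : T ≃ₗ[k] k :=
    { toFun := fun c => c
      invFun := fun c => c
      left_inv := fun _ => rfl
      right_inv := fun _ => rfl
      map_add' := fun _ _ => rfl
      map_smul' := fun c (x : k) => by
        change counit (R := k) (algebraMap k H c) * x = c * x
        simp }
  let e : M ⊗[k] T ≃ₗ[k] M :=
    (TensorProduct.congr (LinearEquiv.refl k M) τ).trans (TensorProduct.rid k M)
  have he : ∀ (m : M) (c : k), e (m ⊗ₜ (c : T)) = c • m := fun m c => rfl
  let e' : DiagTensor k M T ≃ₗ[Hᵐᵒᵖ] M :=
    { e.toAddEquiv with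
      map_smul' := by
        change ∀ (a : Hᵐᵒᵖ) (t : M ⊗[k] T), e (diagAction k H M T a t) = a • e t
        intro a t
        obtain ⟨a, rfl⟩ := op_surjective a
        induction t using TensorProduct.induction_on with
        | zero => simp only [map_zero, smul_zero]
        | add t s ht hs => simp only [map_add, ht, hs, smul_add]
        | tmul m c =>
          rw [diagAction_tmul k H a (ℛ k a), map_sum]
          exact (Finset.sum_congr rfl fun i _ => he _ _).trans
            (sum_counit_smul_smul M a m (show k from c)) }
  exact e'.toModuleIso

/-- The global dimension is bounded by the projective dimension of the regular bimodule:
`M ⊗ -` carries a projective resolution of `k` to one of `M ⊗ k ≃ M`. -/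
theorem hasProjectiveDimensionLT_of_regularBimodule {n : ℕ}
    (h : HasProjectiveDimensionLT (regularBimodule k H) n) (M : ModuleCat.{u} Hᵐᵒᵖ) :
    HasProjectiveDimensionLT M n :=
  have := hasProjectiveDimensionLT_obj (diagFunctor (k := k) M) n _
    (hasProjectiveDimensionLT_trivialRight h)
  hasProjectiveDimensionLT_of_iso (diagTrivialIso (k := k) M) n

theorem HasFiniteGlobalDimension.of_ringEquiv {R S : Type u} [Ring R] [Ring S] (e : R ≃+* S)
    (h : HasFiniteGlobalDimension R) : HasFiniteGlobalDimension S := by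
  obtain ⟨m, hm⟩ := h
  refine ⟨m, fun N => ?_⟩
  let M : ModuleCat.{u} R :=
    let := Module.compHom N e.toRingHom
    ModuleCat.of R N
  have := hm M
  let := RingHomInvPair.of_ringEquiv e
  let := RingHomInvPair.of_ringEquiv e.symm
  let f : M ≃ₛₗ[RingHomClass.toRingHom e] N :=
    { AddEquiv.refl N with
      map_smul' := fun r i => rfl }
  exact ModuleCat.hasProjectiveDimensionLE_of_semiLinearEquiv e f m

theorem HasFiniteGlobalDimension.injectiveDimension_ne_top {R : Type u} [Ring R]
    (h : HasFiniteGlobalDimension R) (N : ModuleCat.{u} R) : injectiveDimension N ≠ ⊤ := by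
  obtain ⟨m, hm⟩ := h
  rw [injectiveDimension_ne_top_iff]
  refine ⟨m, ?_⟩
  change HasInjectiveDimensionLT N (m + 1)
  rw [hasInjectiveDimensionLT_iff.{u}]
  intro i hi Y e
  have := hm Y
  exact Ext.eq_zero_of_hasProjectiveDimensionLT e (m + 1) hi

/-- An isomorphism `e : R ≃ Rᵐᵒᵖ` makes the left module `R` semilinearly isomorphic to the right
module `R`. -/
theorem injectiveDimension_op_eq {R : Type u} [Ring R] (e : R ≃+* Rᵐᵒᵖ) :
    injectiveDimension (ModuleCat.of R R) = injectiveDimension (ModuleCat.of Rᵐᵒᵖ R) := by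
  let := RingHomInvPair.of_ringEquiv e
  let := RingHomInvPair.of_ringEquiv e.symm
  let f : ModuleCat.of R R ≃ₛₗ[RingHomClass.toRingHom e] ModuleCat.of Rᵐᵒᵖ R :=
    { e.toAddEquiv.trans MulOpposite.opAddEquiv.symm with
      map_smul' := fun r i => by
        change unop (e (r * i)) = unop (e i) * unop (e r)
        simp }
  exact ModuleCat.injectiveDimension_eq_of_semiLinearEquiv e f

end GlobalDimension

end

/-! ### The pairing of `H` with `Ext(k, H)` -/

section

open Coalgebra HopfAlgebra Abelian Limits

section DualExt

variable {k H : Type u} [Field k] [Ring H] [HopfAlgebra k H]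

/-- Composition of a fixed class with morphisms, as an additive map. -/
def compMk₀ {R : Type u} [Ring R] {X Y : ModuleCat.{u} R} {i : ℕ} (α : Ext.{u} X Y i)
    (Z : ModuleCat.{u} R) : (Y ⟶ Z) →+ Ext.{u} X Z i where
  toFun f := α.comp (Ext.mk₀ f) (add_zero i)
  map_zero' := by rw [Ext.mk₀_zero, Ext.comp_zero]
  map_add' f g := by rw [Ext.mk₀_add, Ext.comp_add]

theorem compMk₀_apply {R : Type u} [Ring R] {X Y : ModuleCat.{u} R} {i : ℕ} (α : Ext.{u} X Y i)
    {Z : ModuleCat.{u} R} (f : Y ⟶ Z) : compMk₀ α Z f = α.comp (Ext.mk₀ f) (add_zero i) := rfl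

theorem compMk₀_compMk₀ {R : Type u} [Ring R] {X Y : ModuleCat.{u} R} {i : ℕ} (α : Ext.{u} X Y i)
    {Z W : ModuleCat.{u} R} (f : Y ⟶ Z) (g : Z ⟶ W) :
    compMk₀ (compMk₀ α Z f) W g = compMk₀ α W (f ≫ g) := by
  simp only [compMk₀_apply]
  rw [Ext.comp_assoc_of_third_deg_zero, Ext.mk₀_comp_mk₀]

theorem innerAction_apply (a b : H) (r : Env k H) :
    innerAction k H (a ⊗ₜ op b) r = r * (b ⊗ₜ op a) := by
  induction r using TensorProduct.induction_on with
  | zero => rw [zero_mul]; exact map_zero _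
  | add r s hr hs => rw [add_mul, ← hr, ← hs]; exact map_add _ _ _
  | tmul x y =>
    rw [← op_unop y, innerAction_tmul]
    simp

theorem adjHom_op_mul (x y z : H) : adjHom k H (op (x * y)) * lft z =
    adjHom k H (op y) * (adjHom k H (op x) * lft z) := by
  rw [op_mul, map_mul, mul_assoc]

variable (k) in
/-- The map `y ↦ adjHom(y) (z ⊗ 1)` from the free right module `H` to `H^e`. -/
def freeMap : H →+ (ModuleCat.of Hᵐᵒᵖ H ⟶ (adjRestrict k H).obj (envModule k H)) where
  toFun z := ModuleCat.ofHom (Y := (adjRestrict k H).obj (envModule k H))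
    { toFun := fun y => (adjHom k H (op y) * lft z : Env k H)
      map_add' := fun x y => (congrArg (· * (lft z : Env k H)) (map_add (adjHom k H) (op x)
        (op y))).trans (add_mul _ _ _)
      map_smul' := fun a y => adjHom_op_mul (k := k) y (unop a) z }
  map_zero' := by
    ext
    change (adjHom k H (op _) * lft 0 : Env k H) = 0
    rw [lft, zero_tmul, mul_zero]
  map_add' x z := by
    ext
    change (adjHom k H (op _) * lft (x + z) : Env k H) = adjHom k H (op _) * lft x +
      adjHom k H (op _) * lft z
    rw [lft, add_tmul, mul_add]

/-- Left multiplication by an element of `H`, as an endomorphism of the right module `H`. -/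
abbrev leftMul (a : H) : ModuleCat.of Hᵐᵒᵖ H ⟶ ModuleCat.of Hᵐᵒᵖ H :=
  ModuleCat.ofHom (Module.toModuleEnd Hᵐᵒᵖ H (S := H) a)

theorem extRestrict_compMk₀ {N N' : ModuleCat.{u} (Env k H)} {i : ℕ}
    (α : Ext.{u} (regularBimodule k H) N i) (f : N ⟶ N') :
    extRestrict N' i (compMk₀ α N' f) =
      compMk₀ (extRestrict N i α) _ ((adjRestrict k H).map f) := by
  rw [compMk₀_apply, compMk₀_apply, extRestrict_comp, Ext.mapExactFunctor_mk₀]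

/-- The isomorphism `Ext^i_{H^e}(H, N) ≃ Ext^i_{Hᵐᵒᵖ}(k, N)`. -/
def extRestrictEquiv (N : ModuleCat.{u} (Env k H)) (i : ℕ) :
    Ext.{u} (regularBimodule k H) N i ≃+ Ext.{u} (trivialRight (Bialgebra.counitAlgHom k H))
      ((adjRestrict k H).obj N) i :=
  AddEquiv.ofBijective (extRestrict N i) (extRestrict_bijective _ i)

variable (k H) in
/-- The class in `Ext^i_{H^e}(H, H^e)` attached to `z ∈ H` and `α ∈ Ext^i_{Hᵐᵒᵖ}(k, H)`: the image
of `α` under the map `y ↦ adjHom(y) (z ⊗ 1)`. -/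
def extPair (i : ℕ) (z : H)
    (α : Ext.{u} (trivialRight (Bialgebra.counitAlgHom k H)) (ModuleCat.of Hᵐᵒᵖ H) i) :
    Ext.{u} (regularBimodule k H) (envModule k H) i :=
  (extRestrictEquiv _ i).symm (compMk₀ α _ (freeMap k z))

variable {i : ℕ} (α β : Ext.{u} (trivialRight (Bialgebra.counitAlgHom k H))
  (ModuleCat.of Hᵐᵒᵖ H) i)

theorem extRestrict_extPair (z : H) :
    extRestrict (envModule k H) i (extPair k H i z α) = compMk₀ α _ (freeMap k z) :=
  (extRestrictEquiv (envModule k H) i).apply_symm_apply _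

theorem extRestrict_injective (N : ModuleCat.{u} (Env k H)) (i : ℕ) :
    Function.Injective (extRestrict N i) := (extRestrict_bijective N i).1

theorem extPair_add (z : H) : extPair k H i z (α + β) = extPair k H i z α + extPair k H i z β := by
  apply extRestrict_injective
  rw [map_add]
  simp only [extRestrict_extPair, compMk₀_apply, Ext.add_comp]

theorem extPair_zero (z : H) : extPair k H i z 0 = 0 := by
  apply extRestrict_injective
  rw [map_zero]
  simp only [extRestrict_extPair, compMk₀_apply, Ext.zero_comp]

theorem add_extPair (z w : H) :
    extPair k H i (z + w) α = extPair k H i z α + extPair k H i w α := by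
  apply extRestrict_injective
  simp only [extRestrict_extPair, map_add]

theorem zero_extPair : extPair k H i 0 α = 0 := by
  apply extRestrict_injective
  simp only [extRestrict_extPair, map_zero]

theorem freeMap_smul (c : k) (z : H) :
    freeMap k (c • z) = leftMul (algebraMap k H c) ≫ freeMap k z := by
  refine ModuleCat.hom_ext (LinearMap.ext fun (y : H) => ?_)
  change adjHom k H (op y) * lft (c • z) = adjHom k H (op (algebraMap k H c * y)) * lft z
  rw [op_mul, ← MulOpposite.algebraMap_apply, map_mul, AlgHom.commutes, mul_assoc,
    ← Algebra.smul_def, lft, smul_tmul']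

theorem smul_extPair (c : k) (z : H) :
    extPair k H i (c • z) α = extPair k H i z (compMk₀ α _ (leftMul (algebraMap k H c))) := by
  apply extRestrict_injective
  rw [extRestrict_extPair, extRestrict_extPair, compMk₀_compMk₀, freeMap_smul]

/-- By the expansion `sum_adjHom_mul_lft`,
`adjHom(y)(z ⊗ 1)(b ⊗ op a) = Σ adjHom(y) adjHom(a₂)(S²(a₁) z b ⊗ 1)`. -/
theorem freeMap_comp_innerAction (a b z : H) {ι : Type*} (r : Repr k a ι) :
    freeMap k z ≫ (adjRestrict k H).map (ModuleCat.ofHom (innerAction k H (a ⊗ₜ op b))) =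
      ∑ j ∈ r.index, leftMul (r.right j) ≫
        freeMap k (antipode k (antipode k (r.left j)) * (z * b)) := by
  refine ModuleCat.hom_ext (LinearMap.ext fun (y : H) => ?_)
  rw [ModuleCat.hom_sum, LinearMap.sum_apply]
  have h : innerAction k H (a ⊗ₜ op b) (adjHom k H (op y) * lft z) = ∑ j ∈ r.index,
      adjHom k H (op (r.right j * y)) * lft (antipode k (antipode k (r.left j)) * (z * b)) := by
    rw [innerAction_apply]
    simp_rw [op_mul, map_mul, mul_assoc]
    rw [← Finset.mul_sum, sum_adjHom_mul_lft (z * b) a r]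
    simp
  exact h

theorem innerAction_extPair (a b z : H) {ι : Type*} (r : Repr k a ι) :
    compMk₀ (extPair k H i z α) _ (ModuleCat.ofHom (innerAction k H (a ⊗ₜ op b))) =
      ∑ j ∈ r.index, extPair k H i (antipode k (antipode k (r.left j)) * (z * b))
        (compMk₀ α _ (leftMul (r.right j))) := by
  apply extRestrict_injective
  rw [extRestrict_compMk₀, extRestrict_extPair, compMk₀_compMk₀,
    freeMap_comp_innerAction a b z r, map_sum, map_sum]
  refine Finset.sum_congr rfl fun j _ => ?_
  rw [extRestrict_extPair, compMk₀_compMk₀]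

end DualExt

end

/-! ### The dualizing bimodule as a tensor product -/

section

open Coalgebra HopfAlgebra Abelian Limits

section Coordinates

variable {k H : Type u} [Field k] [Ring H] [HopfAlgebra k H] {J : Type*} (b : Module.Basis J k H)

/-- The coordinate of an element of `H^e` with respect to the basis `bⱼ ⊗ 1` of `H^e` over
`Hᵐᵒᵖ`. -/
def envCoord (j : J) : Env k H →ₗ[k] H :=
  (TensorProduct.lid k H).toLinearMap ∘ₗ (b.coord j).rTensor H ∘ₗ (envEquiv k H).symm.toLinearMap

theorem envCoord_envEquiv (j : J) (x c : H) :
    envCoord b j (envEquiv k H (x ⊗ₜ c)) = b.coord j x • c := by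
  simp [envCoord]

theorem envCoord_adjHom_mul (j : J) (h : H) (r : Env k H) :
    envCoord b j (adjHom k H (op h) * r) = envCoord b j r * h := by
  obtain ⟨t, rfl⟩ := (envEquiv k H).surjective r
  induction t using TensorProduct.induction_on with
  | zero => simp
  | add t s ht hs => rw [map_add, mul_add, map_add, map_add, ht, hs, add_mul]
  | tmul x c =>
    have h1 : adjHom k H (op h) * envEquiv k H (x ⊗ₜ c) = envEquiv k H (x ⊗ₜ (c * h)) := by
      rw [envEquiv_tmul, envEquiv_tmul, adjHom_op_mul]
    rw [h1, envCoord_envEquiv, envCoord_envEquiv, smul_mul_assoc]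

/-- `envCoord` as a map of right `H`-modules from `H^e` with the adjoint action to `H`. -/
def coordMap (j : J) : (adjRestrict k H).obj (envModule k H) ⟶ ModuleCat.of Hᵐᵒᵖ H :=
  ModuleCat.ofHom (X := (adjRestrict k H).obj (envModule k H))
    { toFun := envCoord b j
      map_add' := map_add (envCoord b j)
      map_smul' := fun a r => envCoord_adjHom_mul b j (unop a) r }

theorem freeMap_coordMap (j : J) (z : H) :
    freeMap k z ≫ coordMap b j = leftMul (algebraMap k H (b.coord j z)) := by
  refine ModuleCat.hom_ext (LinearMap.ext fun (y : H) => ?_)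
  have h : envCoord b j (adjHom k H (op y) * lft z) = algebraMap k H (b.coord j z) * y := by
    rw [← envEquiv_tmul, envCoord_envEquiv, Algebra.smul_def]
  exact h

/-- The idempotent endomorphisms of `H^e` that project onto the span of finitely many of the basis
elements `bⱼ ⊗ 1` eventually fix every element. -/
theorem eventually_sum_coordMap_freeMap (r : (adjRestrict k H).obj (envModule k H)) :
    ∀ᶠ s : Finset J in Filter.atTop, (∑ j ∈ s, coordMap b j ≫ freeMap k (b j)) r = r := by
  have key : ∀ r : Env k H, ∀ᶠ s : Finset J in Filter.atTop,
      ∑ j ∈ s, adjHom k H (op (envCoord b j r)) * lft (b j) = r := by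
    intro r
    obtain ⟨t, rfl⟩ := (envEquiv k H).surjective r
    induction t using TensorProduct.induction_on with
    | zero => simp
    | add t t' ht ht' =>
      filter_upwards [ht, ht'] with s hs hs'
      conv_rhs => rw [map_add, ← hs, ← hs']
      rw [← Finset.sum_add_distrib]
      refine Finset.sum_congr rfl fun j _ => ?_
      rw [map_add, map_add, MulOpposite.op_add, map_add, add_mul]
    | tmul x c =>
      filter_upwards [Filter.eventually_ge_atTop (b.repr x).support] with s hs
      have hx : ∑ j ∈ s, b.repr x j • b j = x := by
        conv_rhs => rw [← b.linearCombination_repr x]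
        rw [Finsupp.linearCombination_apply]
        exact (Finsupp.sum_of_support_subset _ hs (fun j c => c • b j)
          fun j _ => zero_smul k (b j)).symm
      conv_rhs => rw [← hx, sum_tmul, map_sum]
      refine Finset.sum_congr rfl fun j _ => ?_
      rw [envCoord_envEquiv, ← envEquiv_tmul, smul_tmul]
      rfl
  filter_upwards [key r] with s hs
  refine Eq.trans (b := (∑ j ∈ s, coordMap b j ≫ freeMap k (b j)).hom r) rfl ?_
  rw [ModuleCat.hom_sum, LinearMap.sum_apply]
  exact hs

variable {i : ℕ}

theorem extRestrict_extPair_coordMap (j : J) (z : H)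
    (α : Ext.{u} (trivialRight (Bialgebra.counitAlgHom k H)) (ModuleCat.of Hᵐᵒᵖ H) i) :
    compMk₀ (extRestrict (envModule k H) i (extPair k H i z α)) _ (coordMap b j) =
      compMk₀ α _ (leftMul (algebraMap k H (b.coord j z))) := by
  rw [extRestrict_extPair, compMk₀_compMk₀, freeMap_coordMap]

theorem compMk₀_id {R : Type u} [Ring R] {X Y : ModuleCat.{u} R} (α : Ext.{u} X Y i) :
    compMk₀ α _ (𝟙 Y) = α := Ext.comp_mk₀_id α

theorem compMk₀_zero {R : Type u} [Ring R] {X Y Z : ModuleCat.{u} R} (f : Y ⟶ Z) :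
    compMk₀ (0 : Ext.{u} X Y i) Z f = 0 := Ext.zero_comp (h := add_zero i) ..

theorem leftMul_one : leftMul (1 : H) = 𝟙 _ := by
  refine ModuleCat.hom_ext (LinearMap.ext fun (y : H) => one_mul y)

theorem leftMul_zero : leftMul (0 : H) = 0 := by
  refine ModuleCat.hom_ext (LinearMap.ext fun (y : H) => zero_mul y)

/-- Coordinates on `H^e` recover each `t j` from the sum. -/
theorem eq_zero_of_sum_extPair_eq_zero
    (t : J →₀ Ext.{u} (trivialRight (Bialgebra.counitAlgHom k H)) (ModuleCat.of Hᵐᵒᵖ H) i)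
    (ht : ∑ j ∈ t.support, extPair k H i (b j) (t j) = 0) : t = 0 := by
  classical
  ext l
  have h : ∑ j ∈ t.support, compMk₀ (extRestrict (envModule k H) i
      (extPair k H i (b j) (t j))) _ (coordMap b l) = 0 := by
    have := congrArg (fun β => compMk₀ (extRestrict (envModule k H) i β) _ (coordMap b l)) ht
    simp only [map_sum, map_zero] at this
    rw [compMk₀_zero] at this
    exact (map_sum ((Ext.mk₀ (coordMap b l)).postcomp _ (add_zero i)) _ _).symm.trans this
  simp only [extRestrict_extPair_coordMap, Module.Basis.coord_apply, Module.Basis.repr_self] at h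
  by_contra hl
  rw [Finset.sum_eq_single l] at h
  · rw [Finsupp.single_eq_same, map_one, leftMul_one, compMk₀_id] at h
    exact hl h
  · intro j _ hj
    rw [Finsupp.single_eq_of_ne (Ne.symm hj), map_zero, leftMul_zero, map_zero]
  · intro h'
    rw [Finsupp.notMem_support_iff.1 h', compMk₀_zero]

/-- By finiteness of the resolution, a class with values in `H^e` has values in the span of finitely
many basis elements. -/
theorem exists_sum_extPair_eq {n : ℕ} (hH : HasFGResolutionLT n (regularBimodule k H))
    (β : Ext.{u} (regularBimodule k H) (envModule k H) i) :
    ∃ (s : Finset J) (t : J → Ext.{u} (trivialRight (Bialgebra.counitAlgHom k H))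
      (ModuleCat.of Hᵐᵒᵖ H) i), ∑ j ∈ s, extPair k H i (b j) (t j) = β := by
  obtain ⟨s, hs⟩ := (eventually_trivialRight_comp_eq _ (eventually_sum_coordMap_freeMap b) hH
    (extRestrict (envModule k H) i β)).exists
  refine ⟨s, fun j => compMk₀ (extRestrict (envModule k H) i β) _ (coordMap b j), ?_⟩
  apply extRestrict_injective
  rw [map_sum]
  simp only [extRestrict_extPair, compMk₀_compMk₀]
  rw [← map_sum]
  exact hs

variable (k H i) in
/-- `extPair` as a biadditive map. -/
def dualPair : H →+ RightExt (Bialgebra.counitAlgHom k H) i →+ DualExt k H i where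
  toFun z := { toFun := extPair k H i z, map_zero' := extPair_zero z,
               map_add' := fun α β => extPair_add α β z }
  map_zero' := AddMonoidHom.ext zero_extPair
  map_add' z w := AddMonoidHom.ext fun α => add_extPair α z w

variable (k H i) in
/-- The map `H ⊗ Ext^i_{Hᵐᵒᵖ}(k, H) → Ext^i_{H^e}(H, H^e)` given by `extPair`. -/
def dualHom : H ⊗[k] RightExt (Bialgebra.counitAlgHom k H) i →+ DualExt k H i :=
  TensorProduct.liftAddHom (dualPair k H i) fun c z α => smul_extPair α c z

theorem dualHom_tmul (z : H) (α : RightExt (Bialgebra.counitAlgHom k H) i) :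
    dualHom k H i (z ⊗ₜ α) = dualPair k H i z α := rfl

theorem dualHom_bijective {n : ℕ} (hH : HasFGResolutionLT n (regularBimodule k H)) :
    Function.Bijective (dualHom k H i) := by
  classical
  let b := Module.Basis.ofVectorSpace k H
  constructor
  · rw [injective_iff_map_eq_zero]
    intro x hx
    obtain ⟨t, rfl⟩ := (TensorProduct.equivFinsuppOfBasisLeft b).symm.surjective x
    rw [TensorProduct.equivFinsuppOfBasisLeft_symm_apply, Finsupp.sum, map_sum] at hx
    have ht : t = 0 := eq_zero_of_sum_extPair_eq_zero b t hx
    rw [ht, map_zero]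
  · intro β
    obtain ⟨s, t, rfl⟩ := exists_sum_extPair_eq b hH β
    refine ⟨∑ j ∈ s, b j ⊗ₜ t j, ?_⟩
    rw [map_sum]
    rfl

/-- The bimodule structure of `H ⊗ Ext^i_{Hᵐᵒᵖ}(k, H)`: `a (z ⊗ α) b = Σ S²(a₁) z b ⊗ a₂ α`. -/
theorem smul_dualPair (a b z : H) (α : RightExt (Bialgebra.counitAlgHom k H) i)
    {ι : Type*} (r : Repr k a ι) :
    (a ⊗ₜ op b : Env k H) • dualPair k H i z α = ∑ j ∈ r.index,
      dualPair k H i (antipode k (antipode k (r.left j)) * (z * b)) (r.right j • α) :=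
  innerAction_extPair α a b z r

end Coordinates

end

/-! ### Invertible bimodules -/

section Invertible

variable {k A : Type u} [Field k] [Ring A] [Algebra k A] {U V : Type u} [AddCommGroup U]
  [Module (Env k A) U] [AddCommGroup V] [Module (Env k A) V]

theorem bmk_rgt_smul (a : A) (u : U) (v : V) :
    bmk k A ((rgt a : Env k A) • u) v = bmk k A u ((lft a : Env k A) • v) := by
  refine (QuotientAddGroup.eq_iff_sub_mem).2 (AddSubgroup.subset_closure ⟨u, a, v, rfl⟩)

variable (k A) in
/-- `bmk` as a biadditive map. -/
def bmkHom : U →+ V →+ BalancedTensor k A U V where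
  toFun u :=
    { toFun := bmk k A u
      map_zero' := congrArg _ (tmul_zero V u)
      map_add' := fun v w => congrArg _ (tmul_add u v w) }
  map_zero' := AddMonoidHom.ext fun v => congrArg _ (zero_tmul U v)
  map_add' u w := AddMonoidHom.ext fun v => congrArg _ (add_tmul u w v)

theorem bmkHom_apply (u : U) (v : V) : bmkHom k A u v = bmk k A u v := rfl

theorem balancedTensor_induction {p : BalancedTensor k A U V → Prop}
    (hb : ∀ u v, p (bmk k A u v)) (h0 : p 0) (ha : ∀ x y, p x → p y → p (x + y)) (x) : p x := by
  induction x using QuotientAddGroup.induction_on with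
  | H x =>
    induction x using TensorProduct.induction_on with
    | zero => exact h0
    | tmul u v => exact hb u v
    | add x y hx hy => exact ha _ _ hx hy

/-- A biadditive map on `U × V` that is balanced over `A` factors through `U ⊗_A V`. -/
theorem exists_balancedLift {W : Type*} [AddCommGroup W] (f : U →+ V →+ W)
    (hf : ∀ (u : U) (a : A) (v : V), f ((rgt a : Env k A) • u) v = f u ((lft a : Env k A) • v)) :
    ∃ F : BalancedTensor k A U V →+ W, ∀ u v, F (bmk k A u v) = f u v := by
  let L : U ⊗[ℤ] V →+ W := TensorProduct.liftAddHom f fun n u v => by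
    rw [map_zsmul, map_zsmul, AddMonoidHom.zsmul_apply]
  have hL : balancedSubgroup k A U V ≤ L.ker := by
    refine (AddSubgroup.closure_le _).2 ?_
    rintro _ ⟨u, a, v, rfl⟩
    refine (map_sub L _ _).trans (sub_eq_zero.2 (hf u a v))
  exact ⟨QuotientAddGroup.lift _ L hL, fun u v => rfl⟩

theorem smul_lft_mul (a b : A) (v : V) :
    (lft a : Env k A) • (lft b : Env k A) • v = (lft (a * b) : Env k A) • v := by
  rw [← mul_smul]; simp

theorem lft_smul_rgt_smul (a b : A) (v : V) :
    (lft a : Env k A) • (rgt b : Env k A) • v = (rgt b : Env k A) • (lft a : Env k A) • v := by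
  rw [← mul_smul, ← mul_smul]; simp

theorem lft_one_smul (v : V) : (lft (1 : A) : Env k A) • v = v := one_smul (Env k A) v

theorem rgt_one_smul (v : V) : (rgt (1 : A) : Env k A) • v = v := one_smul (Env k A) v

/-- If the invertible bimodule `U` is free on one generator as a right module, with `a` acting
on the left through the endomorphism `σ` of `A`, then `σ` is bijective. -/
theorem bijective_of_isInvertibleBimodule (σ : A →ₐ[k] A) (Ψ : A ≃+ U)
    (hΨ : ∀ a b x : A, (a ⊗ₜ[k] op b : Env k A) • Ψ x = Ψ (σ a * (x * b)))
    (hU : IsInvertibleBimodule k A U) : Function.Bijective σ := by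
  obtain ⟨V, _, _, ⟨φ, hφ⟩, ⟨χ, hχ⟩⟩ := hU
  have hl : ∀ a x : A, (lft a : Env k A) • Ψ x = Ψ (σ a * x) := fun a x => by
    have := hΨ a 1 x
    rwa [mul_one] at this
  have hr : ∀ b x : A, (rgt b : Env k A) • Ψ x = Ψ (x * b) := fun b x => by
    have := hΨ 1 b x
    rwa [map_one, one_mul] at this
  -- `V` is free of rank one as a right module, since `v ↦ Ψ 1 ⊗ v` identifies it with `U ⊗ V`.
  let g : V →+ A := φ.toAddMonoidHom.comp (bmkHom k A (Ψ 1))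
  have hg : ∀ v, g v = φ (bmk k A (Ψ 1) v) := fun v => rfl
  have hgr : ∀ b v, g ((rgt b : Env k A) • v) = g v * b := fun b v => by
    have := hφ 1 b (Ψ 1) v
    rwa [lft_one_smul, one_mul] at this
  have hgl : ∀ a v, g ((lft (σ a) : Env k A) • v) = a * g v := fun a v => by
    have := hφ a 1 (Ψ 1) v
    rw [rgt_one_smul, hl, mul_one, mul_one] at this
    rw [hg, ← bmk_rgt_smul, hr, one_mul, this, hg]
  have hsurj : Function.Surjective g := fun h => by
    have : ∀ x : BalancedTensor k A U V, ∃ v, bmkHom k A (Ψ 1) v = x := by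
      refine balancedTensor_induction (fun u v => ?_) ⟨0, map_zero _⟩ ?_
      · obtain ⟨x, rfl⟩ := Ψ.surjective u
        refine ⟨(lft x : Env k A) • v, ?_⟩
        rw [bmkHom_apply, ← bmk_rgt_smul, hr, one_mul]
      · rintro _ _ ⟨v, rfl⟩ ⟨w, rfl⟩
        exact ⟨v + w, map_add _ _ _⟩
    obtain ⟨v, hv⟩ := this (φ.symm h)
    exact ⟨v, by rw [hg, ← bmkHom_apply, hv, φ.apply_symm_apply]⟩
  have hinj : Function.Injective g := by
    let f : U →+ V →+ V := AddMonoidHom.comp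
      { toFun := fun x => DistribSMul.toAddMonoidHom V (lft x : Env k A)
        map_zero' := by
          ext v
          change (lft (0 : A) : Env k A) • v = 0
          rw [lft, zero_tmul]
          exact zero_smul (Env k A) v
        map_add' := fun x y => by
          ext v
          change (lft (x + y) : Env k A) • v = (lft x : Env k A) • v + (lft y : Env k A) • v
          rw [lft, add_tmul, add_smul] } Ψ.symm.toAddMonoidHom
    have hf : ∀ x v, f (Ψ x) v = (lft x : Env k A) • v := fun x v => by
      change (lft (Ψ.symm (Ψ x)) : Env k A) • v = _
      rw [Ψ.symm_apply_apply]
    obtain ⟨F, hF⟩ := exists_balancedLift f fun u a v => by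
      obtain ⟨x, rfl⟩ := Ψ.surjective u
      rw [hr, hf, hf, smul_lft_mul]
    intro v w h
    have h' := congrArg F (φ.injective h)
    rw [bmkHom_apply, bmkHom_apply, hF, hF, hf, hf, lft_one_smul, lft_one_smul] at h'
    exact h'
  -- For `g v₀ = 1`, the relation `σ(a) v₀ = v₀ a` gives injectivity of `σ`.
  obtain ⟨v₀, hv₀⟩ := hsurj 1
  constructor
  · rw [injective_iff_map_eq_zero]
    intro a ha
    have := hgl a v₀
    rw [ha, lft, zero_tmul, hv₀, mul_one] at this
    rw [← this]
    exact (congrArg g (zero_smul (Env k A) v₀)).trans (map_zero g)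
  · -- Given `h`, the element `t = g (h v₀)` satisfies `σ(t) v₀ = h v₀`, so `σ(t)` and `h` agree on
    -- `V = v₀ A`, hence on `V ⊗ U ≃ A`.
    intro h
    refine ⟨g ((lft h : Env k A) • v₀), ?_⟩
    set t := g ((lft h : Env k A) • v₀) with ht
    have h1 : (lft (σ t) : Env k A) • v₀ = (lft h : Env k A) • v₀ :=
      hinj (by rw [hgl, hv₀, mul_one, ht])
    have h2 : ∀ v : V, (lft (σ t) : Env k A) • v = (lft h : Env k A) • v := fun v => by
      have : v = (rgt (g v) : Env k A) • v₀ := hinj (by rw [hgr, hv₀, one_mul])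
      rw [this, lft_smul_rgt_smul, h1, lft_smul_rgt_smul]
    have h3 : ∀ x : BalancedTensor k A V U, σ t * χ x = h * χ x := by
      refine balancedTensor_induction (fun v u => ?_) (by simp) fun x y hx hy => ?_
      · have e1 := hχ (σ t) 1 v u
        have e2 := hχ h 1 v u
        rw [rgt_one_smul, mul_one] at e1 e2
        rw [← e1, ← e2, h2]
      · rw [map_add, mul_add, mul_add, hx, hy]
    have := h3 (χ.symm 1)
    rwa [χ.apply_symm_apply, mul_one, mul_one] at this

theorem rgt_algebraMap (c : k) : (rgt (algebraMap k A c) : Env k A) = algebraMap k (Env k A) c := by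
  rw [rgt, ← MulOpposite.algebraMap_apply, Algebra.TensorProduct.algebraMap_apply']

/-- Let `A` be an augmented algebra and let the bimodule `U` have the form `A ⊗ E` as a right
module, for a vector space `E`. If `U ⊗_A V ≃ A` for some bimodule `V`, then `E` is
one-dimensional. -/
theorem rank_eq_one_of_tensorIsoRegular (ε : A →ₐ[k] k) {E : Type u} [AddCommGroup E] [Module k E]
    (Φ : A ⊗[k] E ≃+ U)
    (hΦ : ∀ (b z : A) (α : E), (rgt b : Env k A) • Φ (z ⊗ₜ α) = Φ ((z * b) ⊗ₜ α))
    (hUV : TensorIsoRegular k A U V) : Module.rank k E = 1 := by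
  obtain ⟨φ, hφ⟩ := hUV
  let i1 : Module k V := Module.compHom V (algebraMap k (Env k A))
  have t1 : IsScalarTower k (Env k A) V :=
    ⟨fun c r x => (congrArg (· • x) (Algebra.smul_def c r)).trans (mul_smul _ _ _)⟩
  have hk : ∀ (c : k) (v : V), c • v = (rgt (algebraMap k A c) : Env k A) • v := fun c v => by
    rw [rgt_algebraMap]; rfl
  have hφr : ∀ u v b, φ (bmk k A u ((rgt b : Env k A) • v)) = φ (bmk k A u v) * b :=
    fun u v b => by
      have := hφ 1 b u v
      rwa [lft_one_smul, one_mul] at this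
  -- The composite of `φ : U ⊗_A V ≃ A` with the augmentation is nonzero and kills `U ⊗ V A⁺`, so
  -- neither `E` nor `V ⧸ V A⁺` vanishes.
  let f : U → V →ₗ[k] k := fun u =>
    { toFun := fun v => ε (φ (bmkHom k A u v))
      map_add' := fun v w => by rw [map_add, map_add, map_add]
      map_smul' := fun c v => by
        rw [hk, bmkHom_apply, hφr, map_mul, AlgHom.commutes, mul_comm]; rfl }
  have hf : ∀ u v, f u v = ε (φ (bmk k A u v)) := fun u v => rfl
  have hne : ¬ ∀ u v, f u v = 0 := fun h => by
    have : ∀ x : BalancedTensor k A U V, ε (φ x) = 0 :=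
      balancedTensor_induction h (by simp) fun x y hx hy => by
        rw [map_add, map_add, hx, hy, add_zero]
    have := this (φ.symm 1)
    rw [φ.apply_symm_apply, map_one] at this
    exact one_ne_zero this
  -- `W = V A⁺`, where `A⁺` is the augmentation ideal, so that `V ⧸ W = V ⊗_A k`.
  let W : Submodule k V := Submodule.span k
    {x | ∃ (b : A) (v : V), x = (rgt b : Env k A) • v - ε b • v}
  have hE : Nontrivial E := by
    by_contra h
    rw [not_nontrivial_iff_subsingleton] at h
    have hU : Subsingleton U := Φ.symm.toEquiv.subsingleton
    refine hne fun u v => ?_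
    rw [hf, ← bmkHom_apply, Subsingleton.elim u 0]
    simp
  have hV : Nontrivial (V ⧸ W) := by
    rw [Submodule.Quotient.nontrivial_iff]
    intro h
    refine hne fun u v => ?_
    have hW : W ≤ LinearMap.ker (f u) := by
      refine Submodule.span_le.2 ?_
      rintro _ ⟨b, v, rfl⟩
      change f u _ = 0
      rw [map_sub, LinearMap.map_smul (f u) (ε b) v, hf, hf, hφr, map_mul, smul_eq_mul, mul_comm,
        sub_self]
    exact hW (h ▸ Submodule.mem_top)
  -- The map `U ⊗_A V → E ⊗ V ⧸ V A⁺` sending `(z ⊗ α) ⊗ v` to `α ⊗ z v`.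
  let A1 : A →ₗ[k] V →ₗ[k] V ⧸ W := (LinearMap.llcomp k V V (V ⧸ W) W.mkQ) ∘ₗ
    (Algebra.lsmul k k V).toLinearMap ∘ₗ
      (Algebra.TensorProduct.includeLeft : A →ₐ[k] Env k A).toLinearMap
  let A2 : E →ₗ[k] (V →ₗ[k] V ⧸ W) →ₗ[k] V →ₗ[k] E ⊗[k] (V ⧸ W) :=
    LinearMap.llcomp k V (V ⧸ W) (E ⊗[k] (V ⧸ W)) ∘ₗ TensorProduct.mk k E (V ⧸ W)
  let lam : A ⊗[k] E →ₗ[k] V →ₗ[k] E ⊗[k] (V ⧸ W) := TensorProduct.lift (A2.flip ∘ₗ A1)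
  have hlam : ∀ z α v, lam (z ⊗ₜ α) v = α ⊗ₜ W.mkQ ((lft z : Env k A) • v) := fun _ _ _ => rfl
  let lamU : U →+ V →+ E ⊗[k] (V ⧸ W) :=
    { toFun := fun u => (lam (Φ.symm u)).toAddMonoidHom
      map_zero' := by ext v; simp
      map_add' := fun u w => by ext v; simp }
  have hlamU : ∀ t v, lamU (Φ t) v = lam t v := fun t v => by
    change lam (Φ.symm (Φ t)) v = _
    rw [Φ.symm_apply_apply]
  obtain ⟨F, hF⟩ := exists_balancedLift lamU fun u a v => by
    obtain ⟨t, rfl⟩ := Φ.surjective u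
    induction t using TensorProduct.induction_on with
    | zero => simp
    | add t s ht hs =>
      rw [map_add, smul_add (rgt a : Env k A), map_add, map_add, AddMonoidHom.add_apply, ht, hs,
        AddMonoidHom.add_apply]
    | tmul z α => rw [hΦ, hlamU, hlamU, hlam, hlam, smul_lft_mul]
  have hlamr : ∀ t b v, lam t ((rgt b : Env k A) • v) = ε b • lam t v := fun t b v => by
    induction t using TensorProduct.induction_on with
    | zero => simp
    | add t s ht hs => rw [map_add, LinearMap.add_apply, ht, hs, LinearMap.add_apply, smul_add]
    | tmul z α =>
      rw [hlam, hlam, lft_smul_rgt_smul, ← tmul_smul, ← map_smul]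
      congr 1
      rw [← sub_eq_zero, ← map_sub, Submodule.mkQ_apply, Submodule.Quotient.mk_eq_zero]
      exact Submodule.subset_span ⟨b, _, rfl⟩
  have hFr : ∀ x b, F (φ.symm (φ x * b)) = ε b • F x := by
    refine balancedTensor_induction (fun u v b => ?_) (fun b => by simp) fun x y hx hy b => ?_
    · rw [← hφr, φ.symm_apply_apply, hF, hF]
      obtain ⟨t, rfl⟩ := Φ.surjective u
      rw [hlamU, hlamU, hlamr]
    · rw [map_add, add_mul, map_add, map_add, hx, hy, map_add, smul_add]
  -- `F` factors through the augmentation of `A ≃ U ⊗_A V`, so its image is at most a line. This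
  -- image contains all `α ⊗ v`.
  have hspan : ∀ x, F x = ε (φ x) • F (φ.symm 1) := fun x => by
    have := hFr (φ.symm 1) (φ x)
    rwa [φ.apply_symm_apply, one_mul, φ.symm_apply_apply] at this
  have hle : Module.rank k (E ⊗[k] (V ⧸ W)) ≤ 1 := by
    rw [rank_le_one_iff]
    refine ⟨F (φ.symm 1), fun t => ?_⟩
    induction t using TensorProduct.induction_on with
    | zero => exact ⟨0, zero_smul _ _⟩
    | add t s ht hs =>
      obtain ⟨a, rfl⟩ := ht
      obtain ⟨b, rfl⟩ := hs
      exact ⟨a + b, add_smul _ _ _⟩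
    | tmul α v =>
      obtain ⟨v, rfl⟩ := W.mkQ_surjective v
      refine ⟨ε (φ (bmk k A (Φ (1 ⊗ₜ α)) v)), ?_⟩
      rw [← hspan, hF, hlamU, hlam, lft_one_smul]
  rw [rank_tensorProduct'] at hle
  have h1 : 1 ≤ Module.rank k E := Cardinal.one_le_iff_pos.2 rank_pos
  have h2 : 1 ≤ Module.rank k (V ⧸ W) := Cardinal.one_le_iff_pos.2 rank_pos
  exact le_antisymm ((le_mul_of_one_le_right' h2).trans hle) h1

end Invertible

/-! ### The homological integral and the dualizing bimodule -/

section

open Coalgebra HopfAlgebra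

section Integral

variable {k A : Type u} [Field k] [Ring A] [Algebra k A] {E : Type u} [AddCommGroup E] [Module A E]
  [Module k E] [IsScalarTower k A E]

/-- A ring acts on a module that is one-dimensional over the ground field by a character. -/
theorem existsUnique_smul_eq_of_rank_eq_one (h : Module.rank k E = 1) :
    ∃! π : A →ₐ[k] k, ∀ (a : A) (α : E), a • α = π a • α := by
  obtain ⟨α₀, h0, hspan⟩ := rank_eq_one_iff.1 h
  have hinj : ∀ {c d : k}, c • α₀ = d • α₀ → c = d := fun h => smul_left_injective k h0 h
  have hcomm : ∀ (a : A) (c : k) (α : E), a • c • α = c • a • α := fun a c α => by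
    rw [← algebraMap_smul A c α, ← algebraMap_smul A c (a • α), ← mul_smul, ← mul_smul,
      Algebra.commutes]
  choose p hp using fun a : A => hspan (a • α₀)
  let π : A →ₐ[k] k := AlgHom.ofLinearMap
    { toFun := p
      map_add' := fun a b => hinj (by rw [hp, add_smul, add_smul, hp, hp])
      map_smul' := fun c a => hinj (by
        rw [hp, RingHom.id_apply, smul_eq_mul, mul_smul, hp, smul_assoc]) }
    (hinj (by rw [LinearMap.coe_mk, AddHom.coe_mk, hp, one_smul, one_smul]))
    (fun a b => hinj (by
      rw [LinearMap.coe_mk, AddHom.coe_mk, hp, mul_smul, ← hp b, hcomm, ← hp a, ← mul_smul,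
        mul_comm]))
  refine ⟨π, fun a α => ?_, fun π' h' => AlgHom.ext fun a => hinj ?_⟩
  · obtain ⟨c, rfl⟩ := hspan α
    rw [hcomm, ← hp a, ← mul_smul, ← mul_smul, mul_comm]
    rfl
  · rw [← h']
    exact (hp a).symm

end Integral

section Duality

variable {k H : Type u} [Field k] [Ring H] [HopfAlgebra k H] {i n : ℕ}

instance (ε : H →ₐ[k] k) : IsScalarTower k H (RightExt ε i) :=
  ⟨fun c a α => (congrArg (· • α) (Algebra.smul_def c a)).trans (mul_smul _ _ _)⟩

/-- The isomorphism `H ⊗ Ext^i_{Hᵐᵒᵖ}(k, H) ≃ Ext^i_{H^e}(H, H^e)`. -/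
def dualEquiv (hH : HasFGResolutionLT n (regularBimodule k H)) (i : ℕ) :
    H ⊗[k] RightExt (Bialgebra.counitAlgHom k H) i ≃+ DualExt k H i :=
  AddEquiv.ofBijective (dualHom k H i) (dualHom_bijective hH)

theorem rgt_smul_dualPair (b z : H) (α : RightExt (Bialgebra.counitAlgHom k H) i) :
    (rgt b : Env k H) • dualPair k H i z α = dualPair k H i (z * b) α := by
  rw [rgt, smul_dualPair 1 b z α (ι := Unit)
    { index := {()}, left := fun _ => 1, right := fun _ => 1, eq := by simp; rfl }]
  simp

theorem dualPair_smul (c : k) (z : H) (α : RightExt (Bialgebra.counitAlgHom k H) i) :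
    dualPair k H i z (c • α) = dualPair k H i (c • z) α := by
  rw [← dualHom_tmul, ← dualHom_tmul, smul_tmul]

/-- In terms of the integral `π`, the left action is the multiplication by
`S²(a₁) π(a₂) = S²(Ξ_π(a))`. -/
theorem smul_dualPair_of_isRightHomologicalIntegral {π : H →ₐ[k] k}
    (hπ : IsRightHomologicalIntegral (Bialgebra.counitAlgHom k H) i π) (a b z : H)
    (α : RightExt (Bialgebra.counitAlgHom k H) i) :
    (a ⊗ₜ op b : Env k H) • dualPair k H i z α =
      dualPair k H i ((antipodeSq k H).comp (rightWinding π) a * (z * b)) α := by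
  rw [smul_dualPair a b z α (ℛ k a), AlgHom.comp_apply, rightWinding_apply π a (ℛ k a), map_sum,
    Finset.sum_mul, map_sum, AddMonoidHom.finsetSum_apply]
  refine Finset.sum_congr rfl fun j _ => ?_
  rw [hπ, dualPair_smul, map_smul (antipodeSq k H), smul_mul_assoc]
  rfl

theorem subsingleton_rightExt (hH : HasFGResolutionLT n (regularBimodule k H))
    (h : Subsingleton (DualExt k H i)) :
    Subsingleton (RightExt (Bialgebra.counitAlgHom k H) i) := by
  refine subsingleton_of_forall_eq 0 fun α => ?_
  have h1 : (1 : H) ⊗ₜ[k] α = 0 := (dualEquiv hH i).injective (Subsingleton.elim _ _)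
  have h2 := congrArg ((TensorProduct.lid k _).toLinearMap ∘ₗ
    LinearMap.rTensor _ (counit (R := k) (A := H))) h1
  simpa using h2

theorem HasVanDenBerghDuality.rightArtinSchelterCondition {d : ℕ}
    (hH : HasVanDenBerghDuality k H d) :
    RightArtinSchelterCondition (Bialgebra.counitAlgHom k H) d := fun i => by
  obtain ⟨n, hn⟩ := hH.smooth.hasFGResolutionLT
  split_ifs with hi
  · subst hi
    obtain ⟨V, _, _, hV, -⟩ := hH.invertible
    exact rank_eq_one_of_tensorIsoRegular (Bialgebra.counitAlgHom k H) (dualEquiv hn i)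
      (fun b z α => rgt_smul_dualPair b z α) hV
  · have := subsingleton_rightExt hn (hH.vanishing i hi)
    exact rank_subsingleton' k _

/-- A generator `α` of the line `Ext^i_{Hᵐᵒᵖ}(k, H)` identifies `H` with
`Ext^i_{H^e}(H, H^e)`. -/
theorem bijective_dualPair_flip (hH : HasFGResolutionLT n (regularBimodule k H))
    {α : RightExt (Bialgebra.counitAlgHom k H) i} (h0 : α ≠ 0)
    (hα : ∀ β : RightExt (Bialgebra.counitAlgHom k H) i, ∃ c : k, c • α = β) :
    Function.Bijective ((dualPair k H i).flip α) := by
  let e : k ≃ₗ[k] RightExt (Bialgebra.counitAlgHom k H) i :=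
    LinearEquiv.ofBijective (LinearMap.toSpanSingleton k _ α)
      ⟨fun c d h => smul_left_injective k h0 h, hα⟩
  let f : H ≃ₗ[k] H ⊗[k] RightExt (Bialgebra.counitAlgHom k H) i :=
    (TensorProduct.rid k H).symm.trans (TensorProduct.congr (LinearEquiv.refl k H) e)
  have h : ⇑((dualPair k H i).flip α) = dualEquiv hH i ∘ f := funext fun z => by
    change dualPair k H i z α = dualPair k H i z ((1 : k) • α)
    rw [one_smul]
  rw [h]
  exact (dualEquiv hH i).bijective.comp f.bijective

theorem bijective_antipode_of_bijective_antipodeSq (h : Function.Bijective (antipodeSq k H)) :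
    Function.Bijective (antipode k : H →ₗ[k] H) := by
  have h' : Function.Bijective (antipode k ∘ antipode k : H → H) := h
  exact ⟨h'.1.of_comp, h'.2.of_comp⟩

/-- A bijective antipode is an isomorphism of `H` with its opposite. -/
def antipodeRingEquiv (h : Function.Bijective (antipode k : H →ₗ[k] H)) : H ≃+* Hᵐᵒᵖ :=
  RingEquiv.ofBijective (antipodeAlgHomOp k H) (opEquiv.bijective.comp h)

theorem HasVanDenBerghDuality.isRightArtinSchelterRegular {d : ℕ} (hH : HasVanDenBerghDuality k H d)
    (hS : Function.Bijective (antipode k : H →ₗ[k] H)) :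
    IsRightArtinSchelterRegular (Bialgebra.counitAlgHom k H) d := by
  obtain ⟨n, hn⟩ := hH.smooth.hasFGResolutionLT
  have hr : HasFiniteGlobalDimension Hᵐᵒᵖ := ⟨n, fun M =>
    have := hasProjectiveDimensionLT_of_regularBimodule hn.hasProjectiveDimensionLT M
    hasProjectiveDimensionLT_of_ge M n (n + 1) n.le_succ⟩
  have hl : HasFiniteGlobalDimension H := hr.of_ringEquiv (antipodeRingEquiv hS).symm
  exact ⟨hH.rightArtinSchelterCondition, hl.injectiveDimension_ne_top _,
    injectiveDimension_op_eq (antipodeRingEquiv hS), hl, hr⟩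

end Duality

end

end

end HopfDuality

theorem proposition1 {k H : Type u} [Field k] [Ring H] [HopfAlgebra k H] (d : ℕ)
    (hH : HopfDuality.HasVanDenBerghDuality k H d) :
    Function.Bijective (HopfAlgebra.antipode k : H →ₗ[k] H) ∧
    HopfDuality.IsRightArtinSchelterRegular (Bialgebra.counitAlgHom k H) d ∧
    (∃! π : H →ₐ[k] k,
      HopfDuality.IsRightHomologicalIntegral (Bialgebra.counitAlgHom k H) d π) ∧
    ∀ π : H →ₐ[k] k,
      HopfDuality.IsRightHomologicalIntegral (Bialgebra.counitAlgHom k H) d π →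
      Nonempty (HopfDuality.DualExt k H d ≃ₗ[HopfDuality.Env k H]
        HopfDuality.leftTwist
          ((HopfDuality.antipodeSq k H).comp (HopfDuality.rightWinding π))) := by
  have hrank : Module.rank k (HopfDuality.RightExt (Bialgebra.counitAlgHom k H) d) = 1 :=
    (hH.rightArtinSchelterCondition d).trans (if_pos rfl)
  have hint : ∃! π : H →ₐ[k] k,
      HopfDuality.IsRightHomologicalIntegral (Bialgebra.counitAlgHom k H) d π :=
    HopfDuality.existsUnique_smul_eq_of_rank_eq_one hrank
  obtain ⟨n, hn⟩ := hH.smooth.hasFGResolutionLT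
  obtain ⟨α, h0, hα⟩ := rank_eq_one_iff.1 hrank
  let Ψ : H ≃+ HopfDuality.DualExt k H d :=
    AddEquiv.ofBijective _ (HopfDuality.bijective_dualPair_flip hn h0 hα)
  have hΨ : ∀ π : H →ₐ[k] k,
      HopfDuality.IsRightHomologicalIntegral (Bialgebra.counitAlgHom k H) d π → ∀ a b x : H,
      (a ⊗ₜ op b : HopfDuality.Env k H) • Ψ x =
        Ψ ((HopfDuality.antipodeSq k H).comp (HopfDuality.rightWinding π) a * (x * b)) :=
    fun π hπ a b x => HopfDuality.smul_dualPair_of_isRightHomologicalIntegral hπ a b x α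
  have hS : Function.Bijective (HopfAlgebra.antipode k : H →ₗ[k] H) := by
    obtain ⟨π, hπ, -⟩ := hint
    have hσ : Function.Bijective (HopfDuality.antipodeSq k H ∘ HopfDuality.rightWinding π) :=
      HopfDuality.bijective_of_isInvertibleBimodule _ Ψ (hΨ π hπ) hH.invertible
    exact HopfDuality.bijective_antipode_of_bijective_antipodeSq
      ((HopfDuality.rightWinding_bijective π).of_comp_iff _ |>.1 hσ)
  refine ⟨hS, hH.isRightArtinSchelterRegular hS, hint, fun π hπ => ?_⟩
  let Θ : H ≃+ HopfDuality.leftTwist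
      ((HopfDuality.antipodeSq k H).comp (HopfDuality.rightWinding π)) := AddEquiv.refl H
  let f : HopfDuality.leftTwist ((HopfDuality.antipodeSq k H).comp (HopfDuality.rightWinding π)) ≃+
      HopfDuality.DualExt k H d := Θ.symm.trans Ψ
  exact ⟨LinearEquiv.symm
    { f with
      map_smul' := HopfDuality.map_env_smul f.toAddMonoidHom
        fun a b x => (hΨ π hπ a b (Θ.symm x)).symm }⟩
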